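/- Let $d\in\mathbb N$, let $g:\mathbb R\to\mathbb R$ and $f:\mathbb T^d\to\mathbb R$, $\mathbb T=\mathbb R/2\pi\mathbb Z$, be real analytic, and let $\omega\in\mathbb R^d$ be an arbitrary frequency vector (no Diophantine or non-resonance condition). Consider, for a real parameter $\varepsilon$, the equation $$\varepsilon\ddot x+\dot x+\varepsilon g(x)=\varepsilon f(\omega t).\qquad(*)$$ Let $f_\nu=(2\pi)^{-d}\int_{[0,2\pi]^d}f(\psi)e^{-i\nu\cdot\psi}\,d\psi$, $\nu\in\mathbb Z^d$, be the Fourier coefficients of $f$, and let $f_0:=\sum_{\nu\in\mathbb Z^d,\ \omega\cdot\nu=0}f_\nu$ be the constant term of the quasi-periodic function $t\mapsto f(\omega t)$; if the components of $\omega$ are rationally independent, $f_0$ is simply the Fourier coefficient with index $\nu=0$. Assume that $c_0\in\mathbb R$ is a simple zero of $g(x)-f_0$, that is $g(c_0)=f_0$ and $g'(c_0)\neq0$. Then there exist $\varepsilon_0>0$ and functions $X(\cdot,\varepsilon):\mathbb T^d\to\mathbb R$ such that: (1) for every $|\varepsilon|<\varepsilon_0$ the function $\psi\mapsto X(\psi,\varepsilon)$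 is real analytic on $\mathbb T^d$ and $x_0(t)=c_0+X(\omega t,\varepsilon)$ is a solution of $(*)$ on $\mathbb R$; (2) $X(\psi,\varepsilon)\to0$ as $\varepsilon\to0$, uniformly in $\psi$; (3) if in addition $g'(c_0)>0$, there is $\rho>0$, independent of $\varepsilon$, such that, with $B_\rho=\{(x,y)\in\mathbb R^2:|x-c_0|<\rho,\ |y|<\rho\}$: (a) for $0<\varepsilon<\varepsilon_0$ the solution $x_0$ is locally attractive in the plane $(x,\dot x)$: it is Lyapunov stable (uniformly in the initial time), and for every $t_0\in\mathbb R$ every initial datum $(x(t_0),\dot x(t_0))\in B_\rho$ gives rise to a solution $x$ of $(*)$ for all $t\ge t_0$, which satisfies $x(t)-x_0(t)\to0$ and $\dot x(t)-\dot x_0(t)\to0$ as $t\to+\infty$; (b) for $0<|\varepsilon|<\varepsilon_0$ the solution $x_0$ is unique near $(c_0,0)$: one has $(x_0(t),\dot x_0(t))\in B_\rho$ for all $t\in\mathbb R$, and $x_0$ is the only solution of $(*)$ on $\mathbb R$ with $(x(t),\dot x(t))\in B_\rho$ for all $t\in\mathbb R$. -/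

import Mathlib

open Set Filter Topology MeasureTheory

noncomputable section

/-- The scalar product `ω · ν` of a frequency vector and an integer vector. -/
def freqDot {d : ℕ} (ω : Fin d → ℝ) (ν : Fin d → ℤ) : ℝ :=
  ∑ i, ω i * (ν i : ℝ)

/-- A function on `ℝ^d` which is `2π`-periodic in each variable, i.e. a function on the
torus `𝕋^d = (ℝ / 2πℤ)^d`. -/
def TorusPeriodic {d : ℕ} (F : (Fin d → ℝ) → ℝ) : Prop :=
  ∀ (ψ : Fin d → ℝ) (ν : Fin d → ℤ), F (fun i => ψ i + 2 * Real.pi * (ν i : ℝ)) = F ψ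

/-- Real analytic functions on the torus `𝕋^d`. -/
def TorusAnalytic {d : ℕ} (F : (Fin d → ℝ) → ℝ) : Prop :=
  AnalyticOnNhd ℝ F univ ∧ TorusPeriodic F

/-- The Fourier coefficient `F_ν = (2π)^{-d} ∫_{[0,2π]^d} F(ψ) e^{-i ν·ψ} dψ`. -/
def torusFourierCoeff {d : ℕ} (F : (Fin d → ℝ) → ℝ) (ν : Fin d → ℤ) : ℂ :=
  ((2 * Real.pi) ^ d : ℂ)⁻¹ *
    ∫ ψ in Icc (0 : Fin d → ℝ) (fun _ => 2 * Real.pi),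
      (F ψ : ℂ) * Complex.exp (-Complex.I * (freqDot ψ ν : ℂ))

/-- The constant term `f₀` of the quasi-periodic function `t ↦ f(ω t)`: the sum of the Fourier
coefficients `f_ν` of `f` over all integer vectors `ν` with `ω · ν = 0`. If the components of `ω`
are rationally independent, only `ν = 0` contributes (`meanValue_eq_of_nonresonant`). If not, this
is the zeroth Fourier coefficient that one finds after rewriting `f(ω t)` with a rationally
independent frequency vector. The sum is a real number because `f` is real-valued. -/
def meanValue {d : ℕ} (f : (Fin d → ℝ) → ℝ) (ω : Fin d → ℝ) : ℝ :=
  (∑' ν : {ν : Fin d → ℤ // freqDot ω ν = 0}, torusFourierCoeff f ν.1).re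

theorem meanValue_eq_of_nonresonant {d : ℕ} (f : (Fin d → ℝ) → ℝ) (ω : Fin d → ℝ)
    (hω : ∀ ν : Fin d → ℤ, freqDot ω ν = 0 → ν = 0) :
    meanValue f ω = (torusFourierCoeff f 0).re := by
  have h0 : freqDot ω (0 : Fin d → ℤ) = 0 := by simp [freqDot]
  unfold meanValue
  rw [tsum_eq_single (⟨0, h0⟩ : {ν : Fin d → ℤ // freqDot ω ν = 0})]
  intro ν hν
  exact absurd (Subtype.ext (hω ν.1 ν.2)) hν

/-- `c` is a simple zero of `h`. -/
def IsSimpleZero (h : ℝ → ℝ) (c : ℝ) : Prop :=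
  h c = 0 ∧ deriv h c ≠ 0

/-- On the time interval `J` the function `x` is twice differentiable with velocity `v`, and
`ε ẍ + ẋ + ε g(x) = ε f(ω t)`. -/
def IsSolutionOn {d : ℕ} (ε : ℝ) (g : ℝ → ℝ) (f : (Fin d → ℝ) → ℝ) (ω : Fin d → ℝ)
    (J : Set ℝ) (x v : ℝ → ℝ) : Prop :=
  ∀ t ∈ J, HasDerivWithinAt x (v t) J t ∧
    ∃ a : ℝ, HasDerivWithinAt v a J t ∧ ε * a + v t + ε * g (x t) = ε * f (t • ω)

/-- The motion `t ↦ c₀ + X(ω t)`. -/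
def responseMotion {d : ℕ} (c₀ : ℝ) (X : (Fin d → ℝ) → ℝ) (ω : Fin d → ℝ) (t : ℝ) : ℝ :=
  c₀ + X (t • ω)

/-- Lyapunov stability in the plane `(x, ẋ)` of the motion `x₀`, uniformly in the initial time. -/
def IsLyapunovStable {d : ℕ} (ε : ℝ) (g : ℝ → ℝ) (f : (Fin d → ℝ) → ℝ) (ω : Fin d → ℝ)
    (x₀ : ℝ → ℝ) : Prop :=
  ∀ η > 0, ∃ δ > 0, ∀ (t₀ : ℝ) (x v : ℝ → ℝ), IsSolutionOn ε g f ω (Ici t₀) x v →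
    |x t₀ - x₀ t₀| < δ → |v t₀ - deriv x₀ t₀| < δ →
      ∀ t ≥ t₀, |x t - x₀ t| < η ∧ |v t - deriv x₀ t| < η

/-- Every initial datum `(x₁, v₁)` with `|x₁ - c₀| < ρ` and `|v₁| < ρ`, given at any time `t₀`,
launches a solution for all `t ≥ t₀`, and every such solution is asymptotic to the motion `x₀` in
the plane `(x, ẋ)`. -/
def AttractsBox {d : ℕ} (ε : ℝ) (g : ℝ → ℝ) (f : (Fin d → ℝ) → ℝ) (ω : Fin d → ℝ)
    (x₀ : ℝ → ℝ) (c₀ ρ : ℝ) : Prop :=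
  ∀ t₀ x₁ v₁ : ℝ, |x₁ - c₀| < ρ → |v₁| < ρ →
    (∃ x v : ℝ → ℝ, IsSolutionOn ε g f ω (Ici t₀) x v ∧ x t₀ = x₁ ∧ v t₀ = v₁) ∧
    ∀ x v : ℝ → ℝ, IsSolutionOn ε g f ω (Ici t₀) x v → x t₀ = x₁ → v t₀ = v₁ →
      Tendsto (fun t => x t - x₀ t) atTop (𝓝 0) ∧
      Tendsto (fun t => v t - deriv x₀ t) atTop (𝓝 0)

/-- The trajectory of `x₀` in the plane `(x, ẋ)` lies in the box `|x - c₀| < ρ`, `|ẋ| < ρ`, and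
`x₀` is the only solution on the whole line whose trajectory stays in that box. -/
def UniqueInBox {d : ℕ} (ε : ℝ) (g : ℝ → ℝ) (f : (Fin d → ℝ) → ℝ) (ω : Fin d → ℝ)
    (x₀ : ℝ → ℝ) (c₀ ρ : ℝ) : Prop :=
  (∀ t, |x₀ t - c₀| < ρ ∧ |deriv x₀ t| < ρ) ∧
    ∀ x v : ℝ → ℝ, IsSolutionOn ε g f ω univ x v →
      (∀ t, |x t - c₀| < ρ ∧ |v t| < ρ) → x = x₀

end

/-! Write `x = c₀ + u`, `a = g'(c₀)`, and let `N` collect the terms of order at least two in the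
expansion of `g` at `c₀`. The equation becomes `ε ü + u̇ + ε a u = ε (φ - N u)`, where `φ` is the
oscillating part of the forcing: the condition `g c₀ = f₀` removes exactly the modes with `ω·ν = 0`.
On a mode of frequency `w = ω·ν` the linear part is inverted by `ε / (ε (a - w²) + i w)`. There are
no small divisors: for small `w` the real part of the denominator is of order `ε`, like the
numerator, and for other `w` the imaginary part is bounded below. Hence the inverse `M` is bounded
uniformly in `w` and `|ε| ≤ 1` as soon as `a ≠ 0` (`norm_respSymbol_le`).

In an `ℓ¹` algebra of exponentially weighted Fourier coefficients, `u = M (φ - N u)` is solved by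
contraction on a small ball (`exists_fixedPoint_bilinSeries`). The symbol tends to `0` at every `w ≠
0`, so dominated convergence gives `M φ → 0` and hence `u → 0`
(`tendsto_norm_wMultiplier_respSymbol`). The weights make `u` analytic
(`hasFPowerSeriesOnBall_wEval`), and analyticity of `f` puts `φ` into the algebra
(`exists_torusFourierCoeff_decay`).

If `a > 0`, the difference `ξ` of two solutions near `c₀` satisfies `ε ξ̈ + ξ̇ + ε b ξ = 0`, with
`b` a slope of `g` between `a / 2` and `2 a`. The function `V = (ξ + ε ξ̇)² + (ε ξ̇)²` then obeys `ε
V' ≤ -ε² a V` (`mul_lyapunov_deriv_le`). For `ε > 0` its sublevel sets trap solutions and `V` decays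
exponentially, which gives stability and attraction. For either sign of `ε`, boundedness of `V` on
the whole line forces `V = 0`, which gives uniqueness. -/

noncomputable section

open scoped ComplexConjugate

/-! ### Linear maps out of `ℓ¹` defined by bounded families. -/

section Lift

variable {ι : Type*} {F : Type*} [NormedAddCommGroup F] [NormedSpace ℂ F]

theorem summable_norm_lp_one (u : lp (fun _ : ι => ℂ) 1) : Summable fun i => ‖u i‖ := by
  have h := lp.memℓp u
  simpa using h.summable (by simp)

theorem norm_lp_one (u : lp (fun _ : ι => ℂ) 1) : ‖u‖ = ∑' i, ‖u i‖ := by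
  rw [lp.norm_eq_tsum_rpow (by simp)]
  simp

theorem summable_norm_lp_one_smul {b : ι → F} {C : ℝ} (hb : ∀ i, ‖b i‖ ≤ C)
    (u : lp (fun _ : ι => ℂ) 1) : Summable fun i => ‖u i • b i‖ := by
  refine Summable.of_nonneg_of_le (fun _ => norm_nonneg _) (fun i => ?_)
    ((summable_norm_lp_one u).mul_right C)
  rw [norm_smul]
  exact mul_le_mul_of_nonneg_left (hb i) (norm_nonneg _)

variable [CompleteSpace F]

theorem summable_lp_one_smul {b : ι → F} {C : ℝ} (hb : ∀ i, ‖b i‖ ≤ C)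
    (u : lp (fun _ : ι => ℂ) 1) : Summable fun i => u i • b i :=
  (summable_norm_lp_one_smul hb u).of_norm

/-- The continuous linear map `u ↦ ∑ u i • b i` on `ℓ¹` given by a bounded family `b`. -/
def lpLift (b : ι → F) (C : ℝ) (hb : ∀ i, ‖b i‖ ≤ C) : lp (fun _ : ι => ℂ) 1 →L[ℂ] F :=
  LinearMap.mkContinuous
    { toFun := fun u => ∑' i, u i • b i
      map_add' := fun u v => by
        rw [← (summable_lp_one_smul hb u).tsum_add (summable_lp_one_smul hb v)]
        exact tsum_congr fun i => by simp [add_smul]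
      map_smul' := fun c u => by
        rw [RingHom.id_apply, ← (summable_lp_one_smul hb u).tsum_const_smul]
        exact tsum_congr fun i => by simp [smul_smul] }
    C fun u => by
      refine (norm_tsum_le_tsum_norm (summable_norm_lp_one_smul hb u)).trans ?_
      rw [norm_lp_one, ← tsum_mul_left]
      refine (summable_norm_lp_one_smul hb u).tsum_le_tsum (fun i => ?_)
        ((summable_norm_lp_one u).mul_left C)
      rw [norm_smul, mul_comm]
      exact mul_le_mul_of_nonneg_right (hb i) (norm_nonneg _)

variable {b : ι → F} {C : ℝ} (hb : ∀ i, ‖b i‖ ≤ C)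

theorem lpLift_apply (u : lp (fun _ : ι => ℂ) 1) : lpLift b C hb u = ∑' i, u i • b i := rfl

theorem hasSum_lpLift (u : lp (fun _ : ι => ℂ) 1) :
    HasSum (fun i => u i • b i) (lpLift b C hb u) :=
  (summable_lp_one_smul hb u).hasSum

theorem norm_lpLift_le (hC : 0 ≤ C) : ‖lpLift b C hb‖ ≤ C :=
  LinearMap.mkContinuous_norm_le _ hC _

theorem map_lpLift {G : Type*} [NormedAddCommGroup G] [NormedSpace ℂ G] (T : F →L[ℂ] G)
    (u : lp (fun _ : ι => ℂ) 1) : T (lpLift b C hb u) = ∑' i, u i • T (b i) := by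
  rw [← ((hasSum_lpLift hb u).mapL T).tsum_eq]
  simp

/-- Serves the reflection `wReflHom`, which is additive and continuous but only conjugate-linear. -/
theorem hasSum_lpLift_conj {G : Type*} [NormedAddCommGroup G] [NormedSpace ℂ G] (T : F →+ G)
    (hT : Continuous T) (hc : ∀ (c : ℂ) x, T (c • x) = conj c • T x)
    (u : lp (fun _ : ι => ℂ) 1) :
    HasSum (fun i => conj (u i) • T (b i)) (T (lpLift b C hb u)) := by
  have := (hasSum_lpLift hb u).map T hT
  simpa [Function.comp_def, hc] using this

variable [DecidableEq ι]

theorem lpLift_single (i : ι) (c : ℂ) : lpLift b C hb (lp.single 1 i c) = c • b i := by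
  rw [lpLift_apply, tsum_eq_single i]
  · simp
  · intro j hj
    rw [lp.single_apply_ne _ _ _ hj, zero_smul]

end Lift

/-! ### The weighted Wiener algebra on the torus: product, evaluation, conjugation. -/

section Wiener

variable {d : ℕ}

theorem freqDot_add_right (ω : Fin d → ℝ) (μ ν : Fin d → ℤ) :
    freqDot ω (μ + ν) = freqDot ω μ + freqDot ω ν := by
  simp [freqDot, mul_add, Finset.sum_add_distrib]

theorem freqDot_neg_right (ω : Fin d → ℝ) (ν : Fin d → ℤ) :
    freqDot ω (-ν) = -freqDot ω ν := by
  simp [freqDot]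

theorem freqDot_add_left (x y : Fin d → ℝ) (ν : Fin d → ℤ) :
    freqDot (x + y) ν = freqDot x ν + freqDot y ν := by
  simp [freqDot, add_mul, Finset.sum_add_distrib]

theorem freqDot_smul_left (t : ℝ) (x : Fin d → ℝ) (ν : Fin d → ℤ) :
    freqDot (t • x) ν = t * freqDot x ν := by
  simp [freqDot, Finset.mul_sum, mul_assoc]

/-- The `ℓ¹` norm of an integer vector. -/
def absSum (ν : Fin d → ℤ) : ℝ := ∑ i, |(ν i : ℝ)|

theorem absSum_nonneg (ν : Fin d → ℤ) : 0 ≤ absSum ν :=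
  Finset.sum_nonneg fun _ _ => abs_nonneg _

theorem absSum_add_le (μ ν : Fin d → ℤ) : absSum (μ + ν) ≤ absSum μ + absSum ν := by
  unfold absSum
  rw [← Finset.sum_add_distrib]
  refine Finset.sum_le_sum fun i _ => ?_
  push_cast [Pi.add_apply]
  exact abs_add_le _ _

theorem absSum_neg (ν : Fin d → ℤ) : absSum (-ν) = absSum ν := by
  simp [absSum]

theorem abs_freqDot_le (x : Fin d → ℝ) (ν : Fin d → ℤ) : |freqDot x ν| ≤ ‖x‖ * absSum ν := by
  unfold freqDot absSum
  rw [Finset.mul_sum]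
  refine (Finset.abs_sum_le_sum_abs _ _).trans (Finset.sum_le_sum fun i _ => ?_)
  rw [abs_mul]
  exact mul_le_mul_of_nonneg_right (norm_le_pi_norm x i) (abs_nonneg _)

/-- Coefficient sequences of the Wiener algebra with exponential weights. -/
abbrev CoeffSpace (d : ℕ) : Type := lp (fun _ : Fin d → ℤ => ℂ) 1

/-- The exponential `e^{i ν·ψ}`, normalised by its weight. -/
def wexp (r : ℝ) (ψ : Fin d → ℝ) (ν : Fin d → ℤ) : ℂ :=
  (Real.exp (-(r * absSum ν)) : ℂ) * Complex.exp (Complex.I * (freqDot ψ ν : ℂ))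

theorem norm_cexp_I_mul (x : ℝ) : ‖Complex.exp (Complex.I * (x : ℂ))‖ = 1 := by
  rw [mul_comm]; exact Complex.norm_exp_ofReal_mul_I x

theorem norm_wexp (r : ℝ) (ψ : Fin d → ℝ) (ν : Fin d → ℤ) :
    ‖wexp r ψ ν‖ = Real.exp (-(r * absSum ν)) := by
  rw [wexp, norm_mul, norm_cexp_I_mul, mul_one, Complex.norm_real, Real.norm_eq_abs, Real.abs_exp]

theorem norm_wexp_le {r : ℝ} (hr : 0 ≤ r) (ψ : Fin d → ℝ) (ν : Fin d → ℤ) :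
    ‖wexp r ψ ν‖ ≤ 1 := by
  rw [norm_wexp, Real.exp_le_one_iff]
  have := mul_nonneg hr (absSum_nonneg ν)
  linarith

theorem conj_wexp (r : ℝ) (ψ : Fin d → ℝ) (ν : Fin d → ℤ) :
    conj (wexp r ψ ν) = wexp r ψ (-ν) := by
  simp [wexp, absSum_neg, freqDot_neg_right, ← Complex.exp_conj]

/-- Evaluation at `ψ` of the function with (weighted) Fourier coefficients `u`. -/
def wEval {r : ℝ} (hr : 0 ≤ r) (ψ : Fin d → ℝ) : CoeffSpace d →L[ℂ] ℂ :=
  lpLift (wexp r ψ) 1 (norm_wexp_le hr ψ)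

/-- The structure constants of the convolution product in the normalised basis. -/
def wratio (r : ℝ) (μ ν : Fin d → ℤ) : ℝ :=
  Real.exp (-(r * (absSum μ + absSum ν - absSum (μ + ν))))

theorem wratio_neg (r : ℝ) (μ ν : Fin d → ℤ) : wratio r (-μ) (-ν) = wratio r μ ν := by
  unfold wratio
  rw [← neg_add, absSum_neg, absSum_neg, absSum_neg]

theorem wratio_le {r : ℝ} (hr : 0 ≤ r) (μ ν : Fin d → ℤ) : wratio r μ ν ≤ 1 := by
  rw [wratio, Real.exp_le_one_iff]
  have := mul_nonneg hr (sub_nonneg.2 (absSum_add_le μ ν))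
  linarith

/-- The weights are not multiplicative; their defect `wratio` is at most `1` by the triangle
inequality for `absSum`. This is what makes the convolution submultiplicative. -/
theorem wexp_mul (r : ℝ) (ψ : Fin d → ℝ) (μ ν : Fin d → ℤ) :
    (wratio r μ ν : ℂ) * wexp r ψ (μ + ν) = wexp r ψ μ * wexp r ψ ν := by
  simp only [wratio, wexp, Complex.ofReal_exp]
  rw [← mul_assoc, ← Complex.exp_add, ← Complex.exp_add, ← Complex.exp_add, ← Complex.exp_add,
    ← Complex.exp_add, freqDot_add_right]
  congr 1
  push_cast
  ring

theorem norm_wratio_smul_single_le {r : ℝ} (hr : 0 ≤ r) (μ ν : Fin d → ℤ) :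
    ‖(lp.single 1 (μ + ν) (wratio r μ ν : ℂ) : CoeffSpace d)‖ ≤ 1 := by
  rw [lp.norm_single (by simp), Complex.norm_real, Real.norm_eq_abs, wratio, Real.abs_exp]
  exact wratio_le hr μ ν

/-- Multiplication by the normalised exponential with index `μ`. -/
def wShift {r : ℝ} (hr : 0 ≤ r) (μ : Fin d → ℤ) : CoeffSpace d →L[ℂ] CoeffSpace d :=
  lpLift (fun ν => lp.single 1 (μ + ν) (wratio r μ ν : ℂ)) 1 (norm_wratio_smul_single_le hr μ)

theorem norm_wShift_le {r : ℝ} (hr : 0 ≤ r) (μ : Fin d → ℤ) : ‖wShift hr μ‖ ≤ 1 :=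
  norm_lpLift_le _ zero_le_one

/-- The convolution product. -/
def wConv {r : ℝ} (hr : 0 ≤ r) : CoeffSpace d →L[ℂ] CoeffSpace d →L[ℂ] CoeffSpace d :=
  lpLift (wShift hr) 1 (norm_wShift_le hr)

theorem norm_wConv_le {r : ℝ} (hr : 0 ≤ r) : ‖wConv (d := d) hr‖ ≤ 1 :=
  norm_lpLift_le _ zero_le_one

theorem norm_wConv_apply_le {r : ℝ} (hr : 0 ≤ r) (u v : CoeffSpace d) :
    ‖wConv hr u v‖ ≤ ‖u‖ * ‖v‖ := by
  have h := (wConv hr).le_opNorm₂ u v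
  have h1 := mul_le_mul_of_nonneg_right (norm_wConv_le (d := d) hr) (norm_nonneg u)
  have h2 := mul_le_mul_of_nonneg_right h1 (norm_nonneg v)
  linarith

theorem hasSum_wConv {r : ℝ} (hr : 0 ≤ r) (u v : CoeffSpace d) :
    HasSum (fun μ => u μ • wShift hr μ v) (wConv hr u v) :=
  (hasSum_lpLift (norm_wShift_le hr) u).mapL
    (ContinuousLinearMap.apply ℂ (CoeffSpace d) v)

theorem wEval_wShift {r : ℝ} (hr : 0 ≤ r) (ψ : Fin d → ℝ) (μ : Fin d → ℤ) (v : CoeffSpace d) :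
    wEval hr ψ (wShift hr μ v) = wexp r ψ μ * wEval hr ψ v := by
  rw [wShift, map_lpLift, wEval, lpLift_apply, ← tsum_mul_left]
  refine tsum_congr fun ν => ?_
  rw [lpLift_single, smul_eq_mul, smul_eq_mul, smul_eq_mul, wexp_mul]
  ring

theorem wEval_wConv {r : ℝ} (hr : 0 ≤ r) (ψ : Fin d → ℝ) (u v : CoeffSpace d) :
    wEval hr ψ (wConv hr u v) = wEval hr ψ u * wEval hr ψ v := by
  have h1 := (hasSum_wConv hr u v).mapL (wEval hr ψ)
  have h2 := (hasSum_lpLift (norm_wexp_le hr ψ) u).mul_right (wEval hr ψ v)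
  refine h1.unique (h2.congr_fun fun μ => ?_)
  rw [map_smul, wEval_wShift, smul_eq_mul, smul_eq_mul, mul_assoc]

theorem wEval_norm_le {r : ℝ} (hr : 0 ≤ r) (ψ : Fin d → ℝ) (u : CoeffSpace d) :
    ‖wEval hr ψ u‖ ≤ ‖u‖ := by
  have := (wEval hr ψ).le_of_opNorm_le (norm_lpLift_le (norm_wexp_le hr ψ) zero_le_one) u
  simpa [wEval] using this

/-- The coefficients of the complex conjugate function. -/
def wRefl (u : CoeffSpace d) : CoeffSpace d :=
  ⟨fun ν => conj (u (-ν)), by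
    refine memℓp_gen ?_
    have := (Equiv.neg (Fin d → ℤ)).summable_iff.2 (summable_norm_lp_one u)
    simpa [Function.comp_def] using this⟩

theorem wRefl_apply (u : CoeffSpace d) (ν : Fin d → ℤ) : wRefl u ν = conj (u (-ν)) := rfl

theorem norm_wRefl (u : CoeffSpace d) : ‖wRefl u‖ = ‖u‖ := by
  rw [norm_lp_one, norm_lp_one, ← (Equiv.neg (Fin d → ℤ)).tsum_eq]
  exact tsum_congr fun ν => by simp [wRefl_apply]

theorem wRefl_smul (c : ℂ) (u : CoeffSpace d) : wRefl (c • u) = conj c • wRefl u := by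
  ext ν
  simp [wRefl_apply]

theorem wRefl_single (ν : Fin d → ℤ) (c : ℂ) :
    wRefl (lp.single 1 ν c) = lp.single 1 (-ν) (conj c) := by
  ext μ
  rw [wRefl_apply]
  by_cases h : μ = -ν
  · subst h
    rw [lp.single_apply_self, neg_neg, lp.single_apply_self]
  · rw [lp.single_apply_ne _ _ _ h, lp.single_apply_ne, map_zero]
    exact fun h' => h (by rw [← h', neg_neg])

/-- `wRefl` as an additive homomorphism. -/
def wReflHom : CoeffSpace d →+ CoeffSpace d where
  toFun := wRefl
  map_zero' := by ext ν; simp [wRefl_apply]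
  map_add' u v := by ext ν; simp [wRefl_apply]

theorem wReflHom_apply (u : CoeffSpace d) : wReflHom u = wRefl u := rfl

theorem continuous_wReflHom : Continuous (wReflHom (d := d)) :=
  AddMonoidHomClass.continuous_of_bound wReflHom 1 fun u => by
    rw [wReflHom_apply, norm_wRefl, one_mul]

theorem conj_wEval {r : ℝ} (hr : 0 ≤ r) (ψ : Fin d → ℝ) (u : CoeffSpace d) :
    conj (wEval hr ψ u) = wEval hr ψ (wRefl u) := by
  rw [wEval, lpLift_apply, lpLift_apply, Complex.conj_tsum, ← (Equiv.neg (Fin d → ℤ)).tsum_eq]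
  exact tsum_congr fun ν => by simp [wRefl_apply, conj_wexp]

theorem wEval_im_eq_zero {r : ℝ} (hr : 0 ≤ r) (ψ : Fin d → ℝ) {u : CoeffSpace d}
    (hu : wRefl u = u) : (wEval hr ψ u).im = 0 := by
  rw [← Complex.conj_eq_iff_im, conj_wEval, hu]

theorem wRefl_wShift {r : ℝ} (hr : 0 ≤ r) (μ : Fin d → ℤ) (v : CoeffSpace d) :
    wRefl (wShift hr μ v) = wShift hr (-μ) (wRefl v) := by
  have h1 := hasSum_lpLift_conj (norm_wratio_smul_single_le hr μ) wReflHom continuous_wReflHom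
    wRefl_smul v
  have h2 := (Equiv.neg (Fin d → ℤ)).hasSum_iff.2
    (hasSum_lpLift (norm_wratio_smul_single_le hr (-μ)) (wRefl v))
  refine h1.unique (h2.congr_fun fun ν => ?_)
  simp only [Function.comp_apply, Equiv.neg_apply, wRefl_apply, wReflHom_apply, wRefl_single,
    wratio_neg, neg_neg, neg_add, Complex.conj_ofReal]

/-- Reflection of coefficients is complex conjugation of functions, so it respects products. Its
fixed points, the real functions, can thus serve as an invariant set of the contraction. -/
theorem wRefl_wConv {r : ℝ} (hr : 0 ≤ r) (u v : CoeffSpace d) :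
    wRefl (wConv hr u v) = wConv hr (wRefl u) (wRefl v) := by
  have h1 := (hasSum_wConv hr u v).map wReflHom continuous_wReflHom
  have h2 := (Equiv.neg (Fin d → ℤ)).hasSum_iff.2 (hasSum_wConv hr (wRefl u) (wRefl v))
  refine h1.unique (h2.congr_fun fun ν => ?_)
  simp only [Function.comp_apply, Equiv.neg_apply, wRefl_apply, wReflHom_apply, wRefl_smul,
    wRefl_wShift, neg_neg]

end Wiener

/-! ### Power series in a Banach space with a bilinear product, and the contraction argument. -/

section PowerSeries

variable {E : Type*} [NormedAddCommGroup E] [NormedSpace ℂ E]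

/-- The power `u ^ (k + 1)` for the bilinear product `B`. -/
def bilinPow (B : E →L[ℂ] E →L[ℂ] E) (u : E) : ℕ → E
  | 0 => u
  | k + 1 => B u (bilinPow B u k)

variable {B : E →L[ℂ] E →L[ℂ] E} (hB : ∀ u v, ‖B u v‖ ≤ ‖u‖ * ‖v‖)
include hB

theorem norm_bilinPow_le (u : E) (k : ℕ) : ‖bilinPow B u k‖ ≤ ‖u‖ ^ (k + 1) := by
  induction k with
  | zero => simp [bilinPow]
  | succ k ih =>
    rw [bilinPow, pow_succ']
    exact (hB _ _).trans (mul_le_mul_of_nonneg_left ih (norm_nonneg _))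

/-- The mean value estimate for `t ^ (k + 1)`, obtained by telescoping; neither commutativity nor
associativity of `B` enters. -/
theorem norm_bilinPow_sub_le {δ : ℝ} {u v : E} (hu : ‖u‖ ≤ δ) (hv : ‖v‖ ≤ δ) (k : ℕ) :
    ‖bilinPow B u k - bilinPow B v k‖ ≤ (k + 1) * δ ^ k * ‖u - v‖ := by
  have hδ : 0 ≤ δ := (norm_nonneg u).trans hu
  induction k with
  | zero => simp [bilinPow]
  | succ k ih =>
    have e : bilinPow B u (k + 1) - bilinPow B v (k + 1) =
        B u (bilinPow B u k - bilinPow B v k) + B (u - v) (bilinPow B v k) := by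
      simp [bilinPow]
    rw [e]
    have h1 : ‖B u (bilinPow B u k - bilinPow B v k)‖ ≤ δ * ((k + 1) * δ ^ k * ‖u - v‖) :=
      (hB _ _).trans (mul_le_mul hu ih (norm_nonneg _) hδ)
    have h2 : ‖B (u - v) (bilinPow B v k)‖ ≤ ‖u - v‖ * δ ^ (k + 1) :=
      (hB _ _).trans (mul_le_mul_of_nonneg_left ((norm_bilinPow_le hB v k).trans
        (pow_le_pow_left₀ (norm_nonneg _) hv _)) (norm_nonneg _))
    refine (norm_add_le _ _).trans ((add_le_add h1 h2).trans (le_of_eq ?_))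
    push_cast
    ring

omit hB in
/-- The sum `∑ c k • u ^ (k + 2)` for the bilinear product `B`. -/
def bilinSeries (B : E →L[ℂ] E →L[ℂ] E) (c : ℕ → ℝ) (u : E) : E :=
  ∑' k, (c k : ℂ) • bilinPow B u (k + 1)

variable {c : ℕ → ℝ} {δ₀ : ℝ} (hc : Summable fun k : ℕ => |c k| * (k + 2) * δ₀ ^ k)
include hc

omit [NormedSpace ℂ E] hB in
theorem summable_coeff_mul_pow (hδ₀ : 0 ≤ δ₀) : Summable fun k : ℕ => |c k| * δ₀ ^ (k + 2) := by
  refine Summable.of_nonneg_of_le (fun k => by positivity) (fun k => ?_) (hc.mul_right (δ₀ ^ 2))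
  have : |c k| * δ₀ ^ (k + 2) * 1 ≤ |c k| * δ₀ ^ (k + 2) * (k + 2) :=
    mul_le_mul_of_nonneg_left (by linarith [(Nat.cast_nonneg k : (0 : ℝ) ≤ k)]) (by positivity)
  calc _ ≤ _ := by simpa using this
    _ = _ := by ring

variable [CompleteSpace E]

theorem summable_bilinSeries {u : E} (hu : ‖u‖ ≤ δ₀) :
    Summable fun k => (c k : ℂ) • bilinPow B u (k + 1) := by
  refine Summable.of_norm_bounded
    (summable_coeff_mul_pow hc ((norm_nonneg u).trans hu)) fun k => ?_
  rw [norm_smul, Complex.norm_real, Real.norm_eq_abs]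
  exact mul_le_mul_of_nonneg_left ((norm_bilinPow_le hB u _).trans
    (pow_le_pow_left₀ (norm_nonneg _) hu _)) (abs_nonneg _)

/-- The series starts in degree two, so a factor `δ` splits off from `δ ^ (k + 1)` and the rest is
bounded by `δ₀ ^ k`. The Lipschitz constant is therefore small on small balls. -/
theorem norm_bilinSeries_sub_le {δ : ℝ} (hδ : δ ≤ δ₀) {u v : E} (hu : ‖u‖ ≤ δ) (hv : ‖v‖ ≤ δ) :
    ‖bilinSeries B c u - bilinSeries B c v‖ ≤
      (∑' k : ℕ, |c k| * (k + 2) * δ₀ ^ k) * δ * ‖u - v‖ := by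
  have h0 : 0 ≤ δ := (norm_nonneg u).trans hu
  have key : ∀ k, ‖(c k : ℂ) • bilinPow B u (k + 1) - (c k : ℂ) • bilinPow B v (k + 1)‖ ≤
      |c k| * (k + 2) * δ₀ ^ k * (δ * ‖u - v‖) := by
    intro k
    rw [← smul_sub, norm_smul, Complex.norm_real, Real.norm_eq_abs]
    have h1 := norm_bilinPow_sub_le hB hu hv (k + 1)
    have h2 : ((k + 1 : ℕ) + 1) * δ ^ (k + 1) * ‖u - v‖ ≤
        (k + 2) * δ₀ ^ k * (δ * ‖u - v‖) := by
      calc ((k + 1 : ℕ) + 1) * δ ^ (k + 1) * ‖u - v‖ = (k + 2) * δ ^ k * (δ * ‖u - v‖) := by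
            push_cast; ring
        _ ≤ _ := by gcongr
    calc _ ≤ |c k| * ((k + 2) * δ₀ ^ k * (δ * ‖u - v‖)) :=
          mul_le_mul_of_nonneg_left (h1.trans h2) (abs_nonneg _)
      _ = _ := by ring
  rw [bilinSeries, bilinSeries, ← (summable_bilinSeries hB hc (hu.trans hδ)).tsum_sub
    (summable_bilinSeries hB hc (hv.trans hδ)), mul_assoc, ← tsum_mul_right]
  exact tsum_of_norm_bounded (hc.mul_right _).hasSum key

omit [CompleteSpace E] hB hc in
theorem bilinSeries_zero : bilinSeries B c 0 = 0 := by
  rw [bilinSeries, ← tsum_zero]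
  exact tsum_congr fun k => by simp [bilinPow]

/-- The contraction principle for `u = M (φ - N u)`, where `N` is a power series starting with
quadratic terms. -/
theorem exists_fixedPoint_bilinSeries {δ : ℝ} (hδ0 : 0 ≤ δ) (hδ : δ ≤ δ₀) (M : E →L[ℂ] E) {C : ℝ}
    (hM : ‖M‖ ≤ C)
    (hCδ : C * ((∑' k : ℕ, |c k| * (k + 2) * δ₀ ^ k) * δ) ≤ 1 / 2) (φ : E)
    (hφ : ‖M φ‖ ≤ δ / 2) {S : Set E} (hS : IsClosed S) (h0 : (0 : E) ∈ S)
    (hSS : ∀ u ∈ S, ‖u‖ ≤ δ → M (φ - bilinSeries B c u) ∈ S) :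
    ∃ u ∈ S, ‖u‖ ≤ δ ∧ u = M (φ - bilinSeries B c u) ∧ ‖u‖ ≤ 2 * ‖M φ‖ := by
  have hC : 0 ≤ C := (norm_nonneg M).trans hM
  set Φ : E → E := fun u => M (φ - bilinSeries B c u) with hΦ
  have hlip : ∀ u v, ‖u‖ ≤ δ → ‖v‖ ≤ δ → ‖Φ u - Φ v‖ ≤ 1 / 2 * ‖u - v‖ := by
    intro u v hu hv
    have e : Φ u - Φ v = M (bilinSeries B c v - bilinSeries B c u) := by
      simp [hΦ, ← map_sub]
    rw [e]
    calc _ ≤ C * ‖bilinSeries B c v - bilinSeries B c u‖ := M.le_of_opNorm_le hM _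
      _ ≤ C * ((∑' k : ℕ, |c k| * (k + 2) * δ₀ ^ k) * δ * ‖v - u‖) :=
        mul_le_mul_of_nonneg_left (norm_bilinSeries_sub_le hB hc hδ hv hu) hC
      _ = C * ((∑' k : ℕ, |c k| * (k + 2) * δ₀ ^ k) * δ) * ‖u - v‖ := by
        rw [norm_sub_rev]; ring
      _ ≤ _ := mul_le_mul_of_nonneg_right hCδ (norm_nonneg _)
  have hΦ0 : Φ 0 = M φ := by simp [hΦ, bilinSeries_zero]
  -- With `‖M φ‖ ≤ δ / 2` this maps the ball into itself; at a fixed point it yields `‖u‖ ≤ 2 ‖M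
  -- φ‖`.
  have hbd : ∀ u, ‖u‖ ≤ δ → ‖Φ u‖ ≤ ‖M φ‖ + 1 / 2 * ‖u‖ := by
    intro u hu
    have h1 := hlip u 0 hu (by simpa using hδ0)
    have h2 := norm_sub_norm_le (Φ u) (Φ 0)
    rw [hΦ0] at h1 h2
    rw [sub_zero] at h1
    linarith
  set T : Set E := S ∩ Metric.closedBall 0 δ
  have hT : IsComplete T := (hS.inter Metric.isClosed_closedBall).isComplete
  have hmaps : MapsTo Φ T T := by
    rintro u ⟨hu, hu'⟩
    rw [mem_closedBall_zero_iff] at hu'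
    refine ⟨hSS u hu hu', ?_⟩
    rw [mem_closedBall_zero_iff]
    linarith [hbd u hu']
  have hcontr : ContractingWith (1 / 2) (hmaps.restrict Φ T T) := by
    refine ⟨by norm_num, LipschitzWith.of_dist_le_mul fun u v => ?_⟩
    have hu := mem_closedBall_zero_iff.1 u.2.2
    have hv := mem_closedBall_zero_iff.1 v.2.2
    have := hlip u v hu hv
    rw [Subtype.dist_eq, Subtype.dist_eq, dist_eq_norm, dist_eq_norm]
    simpa using this
  have h0T : (0 : E) ∈ T := ⟨h0, by simpa using hδ0⟩
  obtain ⟨u, huT, hfix, -⟩ := hcontr.exists_fixedPoint' hT hmaps h0T (edist_ne_top _ _)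
  have hu := mem_closedBall_zero_iff.1 huT.2
  have hfix' : Φ u = u := hfix
  refine ⟨u, huT.1, hu, hfix'.symm, ?_⟩
  have := hbd u hu
  rw [hfix'] at this
  linarith

end PowerSeries

/-! ### Power series in the Wiener algebra, evaluated pointwise. -/

section WienerSeries

variable {d : ℕ} {r : ℝ} (hr : 0 ≤ r)

theorem wEval_bilinPow (ψ : Fin d → ℝ) (u : CoeffSpace d) (k : ℕ) :
    wEval hr ψ (bilinPow (wConv hr) u k) = wEval hr ψ u ^ (k + 1) := by
  induction k with
  | zero => simp [bilinPow]
  | succ k ih => rw [bilinPow, wEval_wConv, ih, ← pow_succ']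

theorem wRefl_bilinPow {u : CoeffSpace d} (hu : wRefl u = u) (k : ℕ) :
    wRefl (bilinPow (wConv hr) u k) = bilinPow (wConv hr) u k := by
  induction k with
  | zero => exact hu
  | succ k ih => rw [bilinPow, wRefl_wConv, ih, hu]

variable {c : ℕ → ℝ} {δ₀ : ℝ} (hc : Summable fun k : ℕ => |c k| * (k + 2) * δ₀ ^ k)
include hc

theorem hasSum_wEval_bilinSeries (ψ : Fin d → ℝ) {u : CoeffSpace d} (hu : ‖u‖ ≤ δ₀) :
    HasSum (fun k => (c k : ℂ) * wEval hr ψ u ^ (k + 2))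
      (wEval hr ψ (bilinSeries (wConv hr) c u)) := by
  have h := (summable_bilinSeries (norm_wConv_apply_le hr) hc hu).hasSum.mapL (wEval hr ψ)
  refine h.congr_fun fun k => ?_
  rw [map_smul, wEval_bilinPow, smul_eq_mul]

theorem wRefl_bilinSeries {u : CoeffSpace d} (hu : ‖u‖ ≤ δ₀) (hru : wRefl u = u) :
    wRefl (bilinSeries (wConv hr) c u) = bilinSeries (wConv hr) c u := by
  have h := (summable_bilinSeries (norm_wConv_apply_le hr) hc hu).hasSum
  refine (h.map wReflHom continuous_wReflHom).unique (h.congr_fun fun k => ?_)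
  simp only [Function.comp_apply, wReflHom_apply, wRefl_smul, wRefl_bilinPow hr hru,
    Complex.conj_ofReal]

end WienerSeries

/-! ### Fourier multipliers and differentiation along the flow `t ↦ t ω`. -/

section Multiplier

variable {d : ℕ}

theorem norm_single_le_of_norm_le {m : (Fin d → ℤ) → ℂ} {C : ℝ} (hm : ∀ ν, ‖m ν‖ ≤ C)
    (ν : Fin d → ℤ) : ‖(lp.single 1 ν (m ν) : CoeffSpace d)‖ ≤ C := by
  rw [lp.norm_single (by simp)]
  exact hm ν

/-- The Fourier multiplier with bounded symbol `m`. -/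
def wMultiplier (m : (Fin d → ℤ) → ℂ) (C : ℝ) (hm : ∀ ν, ‖m ν‖ ≤ C) :
    CoeffSpace d →L[ℂ] CoeffSpace d :=
  lpLift (fun ν => lp.single 1 ν (m ν)) C (norm_single_le_of_norm_le hm)

variable {m : (Fin d → ℤ) → ℂ} {C : ℝ} (hm : ∀ ν, ‖m ν‖ ≤ C)

theorem wMultiplier_apply (u : CoeffSpace d) (ν : Fin d → ℤ) :
    wMultiplier m C hm u ν = m ν * u ν := by
  have h := map_lpLift (norm_single_le_of_norm_le hm) (lp.evalCLM ℂ (fun _ => ℂ) 1 ν) u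
  change wMultiplier m C hm u ν = ∑' μ, u μ • (lp.single 1 μ (m μ) : CoeffSpace d) ν at h
  rw [h, tsum_eq_single ν, lp.single_apply_self, smul_eq_mul, mul_comm]
  intro μ hμ
  rw [lp.single_apply_ne _ _ _ hμ.symm, smul_zero]

theorem wRefl_wMultiplier (hc : ∀ ν, conj (m ν) = m (-ν)) (u : CoeffSpace d) :
    wRefl (wMultiplier m C hm u) = wMultiplier m C hm (wRefl u) := by
  ext ν
  rw [wRefl_apply, wMultiplier_apply, wMultiplier_apply, wRefl_apply, map_mul, hc, neg_neg]

theorem wEval_wMultiplier {r : ℝ} (hr : 0 ≤ r) (ψ : Fin d → ℝ) (u : CoeffSpace d) :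
    wEval hr ψ (wMultiplier m C hm u) = ∑' ν, u ν * (m ν * wexp r ψ ν) := by
  rw [wEval, lpLift_apply]
  exact tsum_congr fun ν => by rw [wMultiplier_apply, smul_eq_mul]; ring

theorem norm_wMultiplier_apply_le (hC : 0 ≤ C) (u : CoeffSpace d) :
    ‖wMultiplier m C hm u‖ ≤ C * ‖u‖ :=
  (wMultiplier m C hm).le_of_opNorm_le (norm_lpLift_le _ hC) u

theorem hasDerivAt_wexp_smul (r : ℝ) (ω : Fin d → ℝ) (ν : Fin d → ℤ) (t : ℝ) :
    HasDerivAt (fun t : ℝ => wexp r (t • ω) ν)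
      (Complex.I * (freqDot ω ν : ℂ) * wexp r (t • ω) ν) t := by
  have h1 : HasDerivAt (fun t : ℝ => Complex.I * (freqDot (t • ω) ν : ℂ))
      (Complex.I * (freqDot ω ν : ℂ)) t := by
    have h := ((hasDerivAt_id t).mul_const (freqDot ω ν)).ofReal_comp.const_mul Complex.I
    simpa [freqDot_smul_left] using h
  have h2 := h1.cexp.const_mul (Real.exp (-(r * absSum ν)) : ℂ)
  exact h2.congr_deriv (by rw [wexp]; ring)

/-- Termwise differentiation needs only a bounded differentiated symbol, because the coefficients
are already summable; it works even for `r = 0`. -/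
theorem hasDerivAt_wEval_wMultiplier {r : ℝ} (hr : 0 ≤ r) (ω : Fin d → ℝ)
    {m' : (Fin d → ℤ) → ℂ} {C' : ℝ} (hm' : ∀ ν, ‖m' ν‖ ≤ C')
    (hmm : ∀ ν, m' ν = Complex.I * (freqDot ω ν : ℂ) * m ν) (u : CoeffSpace d) (t : ℝ) :
    HasDerivAt (fun t : ℝ => wEval hr (t • ω) (wMultiplier m C hm u))
      (wEval hr (t • ω) (wMultiplier m' C' hm' u)) t := by
  simp only [wEval_wMultiplier]
  refine hasDerivAt_tsum (u := fun ν => ‖u ν‖ * C') ((summable_norm_lp_one u).mul_right C')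
    (g := fun ν (t : ℝ) => u ν * (m ν * wexp r (t • ω) ν))
    (g' := fun ν (t : ℝ) => u ν * (m' ν * wexp r (t • ω) ν)) (y₀ := 0) ?_ ?_ ?_ t
  · intro ν s
    exact (((hasDerivAt_wexp_smul r ω ν s).const_mul (m ν)).const_mul (u ν)).congr_deriv
      (by rw [hmm]; ring)
  · intro ν s
    rw [norm_mul, norm_mul]
    refine mul_le_mul_of_nonneg_left ?_ (norm_nonneg _)
    have := mul_le_mul (hm' ν) (norm_wexp_le hr (s • ω) ν) (norm_nonneg _)
      ((norm_nonneg _).trans (hm' ν))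
    simpa using this
  · have := summable_lp_one_smul (norm_wexp_le hr ((0 : ℝ) • ω)) (wMultiplier m C hm u)
    refine this.congr fun ν => ?_
    rw [wMultiplier_apply, smul_eq_mul]; ring

end Multiplier

/-! ### Bounds for the inverse of the linearised operator, uniform in `ε`. -/

section Symbol

/-- The symbol of the inverse of `D² + ε⁻¹ D + a`, where `D` acts as `i w`. -/
def respSymbol (a ε w : ℝ) : ℂ :=
  (ε : ℂ) / (((ε * (a - w ^ 2) : ℝ) : ℂ) + (w : ℂ) * Complex.I)

theorem abs_le_norm_respDenom (a ε w : ℝ) :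
    |w| ≤ ‖((ε * (a - w ^ 2) : ℝ) : ℂ) + (w : ℂ) * Complex.I‖ := by
  have := Complex.abs_im_le_norm (((ε * (a - w ^ 2) : ℝ) : ℂ) + (w : ℂ) * Complex.I)
  rw [Complex.add_im, Complex.ofReal_im, Complex.im_ofReal_mul, Complex.I_im, mul_one,
    zero_add] at this
  exact this

theorem abs_mul_le_norm_respDenom (a ε w : ℝ) :
    |ε| * |a - w ^ 2| ≤ ‖((ε * (a - w ^ 2) : ℝ) : ℂ) + (w : ℂ) * Complex.I‖ := by
  rw [← abs_mul]
  have := Complex.abs_re_le_norm (((ε * (a - w ^ 2) : ℝ) : ℂ) + (w : ℂ) * Complex.I)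
  rw [Complex.add_re, Complex.ofReal_re, Complex.re_ofReal_mul, Complex.I_re, mul_zero,
    add_zero] at this
  exact this

theorem respDenom_ne_zero {a ε : ℝ} (ha : a ≠ 0) (hε : ε ≠ 0) (w : ℝ) :
    ((ε * (a - w ^ 2) : ℝ) : ℂ) + (w : ℂ) * Complex.I ≠ 0 := by
  intro h
  have h1 := abs_le_norm_respDenom a ε w
  have h2 := abs_mul_le_norm_respDenom a ε w
  rw [h, norm_zero] at h1 h2
  have hw : w = 0 := abs_eq_zero.1 (le_antisymm h1 (abs_nonneg _))
  rw [hw] at h2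
  have := mul_pos (abs_pos.2 hε) (abs_pos.2 ha)
  simp at h2
  linarith

theorem respSymbol_zero (a w : ℝ) : respSymbol a 0 w = 0 := by simp [respSymbol]

theorem conj_respSymbol (a ε w : ℝ) : conj (respSymbol a ε w) = respSymbol a ε (-w) := by
  simp [respSymbol]

theorem norm_mul_respSymbol_le (a ε w : ℝ) : ‖(w : ℂ) * respSymbol a ε w‖ ≤ |ε| := by
  rw [respSymbol, norm_mul, norm_div, Complex.norm_real, Complex.norm_real, Real.norm_eq_abs,
    Real.norm_eq_abs, mul_div_left_comm]
  have h := div_le_one_of_le₀ (abs_le_norm_respDenom a ε w) (norm_nonneg _)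
  exact mul_le_of_le_one_right (abs_nonneg _) h

/-- A bound for the symbol `respSymbol`, uniform in `|ε| ≤ 1`. -/
def respBound (a : ℝ) : ℝ := 2 / |a| + 1 / √(|a| / 2)

theorem respBound_nonneg (a : ℝ) : 0 ≤ respBound a := by unfold respBound; positivity

/-- If `w² ≤ |a| / 2`, the real part of the denominator is at least `|ε| |a| / 2` in absolute value
and `ε` cancels. Otherwise the imaginary part is at least `√(|a| / 2)`, and `|ε| ≤ 1` suffices. The
two cases give the two terms of `respBound`. -/
theorem norm_respSymbol_le {a ε : ℝ} (ha : a ≠ 0) (hε : |ε| ≤ 1) (w : ℝ) :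
    ‖respSymbol a ε w‖ ≤ respBound a := by
  have ha' : 0 < |a| := abs_pos.2 ha
  have hs : 0 < √(|a| / 2) := Real.sqrt_pos.2 (by positivity)
  by_cases h0 : ε = 0
  · rw [h0, respSymbol_zero, norm_zero]; exact respBound_nonneg a
  have hd := norm_pos_iff.2 (respDenom_ne_zero ha h0 w)
  rw [respSymbol, norm_div, Complex.norm_real, Real.norm_eq_abs, div_le_iff₀ hd, respBound, add_mul]
  by_cases hw : w ^ 2 ≤ |a| / 2
  · have h1 := abs_mul_le_norm_respDenom a ε w
    have h2 : |a| / 2 ≤ |a - w ^ 2| := by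
      have := abs_sub_abs_le_abs_sub a (w ^ 2)
      rw [abs_of_nonneg (sq_nonneg w)] at this
      linarith
    have h3 : |ε| * (|a| / 2) ≤ ‖((ε * (a - w ^ 2) : ℝ) : ℂ) + (w : ℂ) * Complex.I‖ :=
      (mul_le_mul_of_nonneg_left h2 (abs_nonneg _)).trans h1
    have h4 := mul_le_mul_of_nonneg_left h3 (by positivity : 0 ≤ 2 / |a|)
    have h5 : 2 / |a| * (|ε| * (|a| / 2)) = |ε| := by field_simp
    have h6 : 0 ≤ 1 / √(|a| / 2) * ‖((ε * (a - w ^ 2) : ℝ) : ℂ) + (w : ℂ) * Complex.I‖ := by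
      positivity
    linarith
  · have h1 : √(|a| / 2) ≤ |w| := by
      rw [← Real.sqrt_sq_eq_abs w]
      exact Real.sqrt_le_sqrt (not_le.1 hw).le
    have h2 := h1.trans (abs_le_norm_respDenom a ε w)
    have h3 := mul_le_mul_of_nonneg_left h2 (by positivity : 0 ≤ 1 / √(|a| / 2))
    rw [one_div_mul_cancel hs.ne'] at h3
    have h6 : 0 ≤ 2 / |a| * ‖((ε * (a - w ^ 2) : ℝ) : ℂ) + (w : ℂ) * Complex.I‖ := by
      positivity
    linarith

/-- Split `w² = (w² - a) + a`: the first term is absorbed by the real part of the denominator, the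
second by `norm_respSymbol_le`. This is what makes the response twice differentiable in time. -/
theorem norm_sq_mul_respSymbol_le {a ε : ℝ} (ha : a ≠ 0) (hε : |ε| ≤ 1) (w : ℝ) :
    ‖((w ^ 2 : ℝ) : ℂ) * respSymbol a ε w‖ ≤ 1 + |a| * respBound a := by
  by_cases h0 : ε = 0
  · rw [h0, respSymbol_zero, mul_zero, norm_zero]
    have := respBound_nonneg a
    positivity
  have hd := norm_pos_iff.2 (respDenom_ne_zero ha h0 w)
  have h1 : ‖((w ^ 2 - a : ℝ) : ℂ) * respSymbol a ε w‖ ≤ 1 := by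
    rw [respSymbol, norm_mul, norm_div, Complex.norm_real, Complex.norm_real, Real.norm_eq_abs,
      Real.norm_eq_abs, ← mul_div_assoc]
    refine div_le_one_of_le₀ ?_ (norm_nonneg _)
    rw [mul_comm, abs_sub_comm]
    exact abs_mul_le_norm_respDenom a ε w
  have h2 : ‖(a : ℂ) * respSymbol a ε w‖ ≤ |a| * respBound a := by
    rw [norm_mul, Complex.norm_real, Real.norm_eq_abs]
    exact mul_le_mul_of_nonneg_left (norm_respSymbol_le ha hε w) (abs_nonneg _)
  have e : ((w ^ 2 : ℝ) : ℂ) * respSymbol a ε w =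
      ((w ^ 2 - a : ℝ) : ℂ) * respSymbol a ε w + (a : ℂ) * respSymbol a ε w := by
    push_cast; ring
  rw [e]
  exact (norm_add_le _ _).trans (add_le_add h1 h2)

theorem respSymbol_equation {a ε : ℝ} (ha : a ≠ 0) (hε : ε ≠ 0) (w : ℝ) :
    (ε : ℂ) * (Complex.I * w * (Complex.I * w * respSymbol a ε w)) +
      Complex.I * w * respSymbol a ε w + ε * (a * respSymbol a ε w) = ε := by
  have hd := respDenom_ne_zero ha hε w
  have e : respSymbol a ε w * (((ε * (a - w ^ 2) : ℝ) : ℂ) + (w : ℂ) * Complex.I) = ε :=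
    div_mul_cancel₀ _ hd
  push_cast at e
  linear_combination e + ε * w ^ 2 * respSymbol a ε w * Complex.I_sq

theorem tendsto_respSymbol (a : ℝ) {w : ℝ} (hw : w ≠ 0) :
    Tendsto (fun ε => respSymbol a ε w) (𝓝 0) (𝓝 0) := by
  have hw' : 0 < |w| := abs_pos.2 hw
  refine squeeze_zero_norm (a := fun ε => |ε| / |w|) (fun ε => ?_) ?_
  · rw [le_div_iff₀ hw', mul_comm]
    simpa using norm_mul_respSymbol_le a ε w
  · have : Tendsto (fun ε : ℝ => |ε| / |w|) (𝓝 0) (𝓝 (|(0 : ℝ)| / |w|)) :=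
      (continuous_abs.div_const _).tendsto 0
    simpa using this

end Symbol

/-! ### The linear response vanishes as `ε → 0`. -/

section Response

variable {d : ℕ}

/-- The symbol tends to `0` at each nonresonant `ν`, with no uniform rate since the values `ω·ν` may
accumulate at `0`; dominated convergence replaces the rate. Resonant modes have to be absent because
the symbol there equals `1 / a` for `ε ≠ 0`. -/
theorem tendsto_norm_wMultiplier_respSymbol {a : ℝ} (ha : a ≠ 0) (ω : Fin d → ℝ)
    (φ : CoeffSpace d) (hφ : ∀ ν, freqDot ω ν = 0 → φ ν = 0) {δ : ℝ} (hδ : 0 < δ) :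
    ∃ ε₀ > 0, ε₀ ≤ 1 ∧ ∀ ε (_ : |ε| < ε₀)
      (hm : ∀ ν, ‖respSymbol a ε (freqDot ω ν)‖ ≤ respBound a),
      ‖wMultiplier (fun ν => respSymbol a ε (freqDot ω ν)) (respBound a) hm φ‖ < δ := by
  have h : Tendsto (fun ε => ∑' ν, ‖respSymbol a ε (freqDot ω ν) * φ ν‖) (𝓝 0)
      (𝓝 (∑' _ : Fin d → ℤ, (0 : ℝ))) := by
    refine tendsto_tsum_of_dominated_convergence
      ((summable_norm_lp_one φ).mul_left (respBound a)) (fun ν => ?_) ?_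
    · by_cases hν : freqDot ω ν = 0
      · simp [hφ ν hν]
      · have := ((tendsto_respSymbol a hν).mul_const (φ ν)).norm
        simpa using this
    · filter_upwards [Metric.closedBall_mem_nhds (0 : ℝ) one_pos] with ε hε ν
      rw [norm_norm, norm_mul]
      refine mul_le_mul_of_nonneg_right (norm_respSymbol_le ha ?_ _) (norm_nonneg _)
      simpa using hε
  rw [tsum_zero] at h
  obtain ⟨ε₁, hε₁, h1⟩ := Metric.eventually_nhds_iff.1 (h.eventually (gt_mem_nhds hδ))
  refine ⟨min ε₁ 1, by positivity, min_le_right _ _, fun ε hε hm => ?_⟩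
  rw [norm_lp_one]
  simp only [wMultiplier_apply]
  exact h1 (by simpa using hε.trans_le (min_le_left _ _))

end Response

/-! ### Functions with exponentially weighted summable coefficients are analytic. -/

section Analytic

variable {d : ℕ}

/-- `freqDot · ν` as a continuous linear form. -/
def freqDotCLM (ν : Fin d → ℤ) : (Fin d → ℝ) →L[ℝ] ℂ :=
  LinearMap.mkContinuous
    { toFun := fun h => (freqDot h ν : ℂ)
      map_add' := fun x y => by simp [freqDot_add_left]
      map_smul' := fun t x => by simp [freqDot_smul_left] }
    (absSum ν) fun x => by
      change ‖(freqDot x ν : ℂ)‖ ≤ _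
      rw [Complex.norm_real, mul_comm]
      exact abs_freqDot_le x ν

theorem freqDotCLM_apply (ν : Fin d → ℤ) (h : Fin d → ℝ) : freqDotCLM ν h = (freqDot h ν : ℂ) := rfl

theorem norm_freqDotCLM_le (ν : Fin d → ℤ) : ‖freqDotCLM ν‖ ≤ absSum ν :=
  LinearMap.mkContinuous_norm_le _ (absSum_nonneg ν) _

/-- The `k`-th homogeneous term of the exponential `e^{iν·h}`. -/
def expTerm (ν : Fin d → ℤ) (k : ℕ) :
    ContinuousMultilinearMap ℝ (fun _ : Fin k => Fin d → ℝ) ℂ :=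
  (Complex.I ^ k / (k.factorial : ℂ)) •
    (ContinuousMultilinearMap.mkPiAlgebraFin ℝ k ℂ).compContinuousLinearMap fun _ => freqDotCLM ν

theorem expTerm_diag (ν : Fin d → ℤ) (k : ℕ) (h : Fin d → ℝ) :
    expTerm ν k (fun _ => h) = (Complex.I * (freqDot h ν : ℂ)) ^ k / (k.factorial : ℂ) := by
  simp [expTerm, freqDotCLM_apply, List.ofFn_const, mul_pow]
  ring

theorem norm_expTerm_le (ν : Fin d → ℤ) (k : ℕ) :
    ‖expTerm ν k‖ ≤ absSum ν ^ k / k.factorial := by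
  have h1 := (ContinuousMultilinearMap.mkPiAlgebraFin ℝ k ℂ).norm_compContinuousLinearMap_le
    fun _ => freqDotCLM ν
  rw [ContinuousMultilinearMap.norm_mkPiAlgebraFin, one_mul, Finset.prod_const,
    Finset.card_univ, Fintype.card_fin] at h1
  have h2 := h1.trans (pow_le_pow_left₀ (norm_nonneg _) (norm_freqDotCLM_le ν) k)
  rw [expTerm, norm_smul, norm_div, norm_pow, Complex.norm_I, one_pow, Complex.norm_natCast,
    div_mul_eq_mul_div, one_mul]
  gcongr

/-- By `x ^ k / k! ≤ e ^ x` with `x = r * absSum ν`, the weight pays for derivatives of every order,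
uniformly in `ν`; hence a Taylor radius of at least `r`. -/
theorem norm_wexp_smul_expTerm_le {r : ℝ} (hr : 0 < r) (ψ : Fin d → ℝ) (k : ℕ) (ν : Fin d → ℤ) :
    ‖wexp r ψ ν • expTerm ν k‖ ≤ (r ^ k)⁻¹ := by
  rw [norm_smul, norm_wexp]
  have h1 := Real.pow_div_factorial_le_exp (r * absSum ν)
    (mul_nonneg hr.le (absSum_nonneg ν)) k
  have h2 := norm_expTerm_le ν k
  have h3 : r ^ k * (absSum ν ^ k / k.factorial) ≤ Real.exp (r * absSum ν) := by
    rw [← mul_div_assoc, ← mul_pow]; exact h1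
  rw [← one_div, le_div_iff₀ (by positivity), Real.exp_neg]
  calc _ ≤ (Real.exp (r * absSum ν))⁻¹ * (absSum ν ^ k / k.factorial) * r ^ k := by gcongr
    _ = (Real.exp (r * absSum ν))⁻¹ * (r ^ k * (absSum ν ^ k / k.factorial)) := by ring
    _ ≤ (Real.exp (r * absSum ν))⁻¹ * Real.exp (r * absSum ν) := by gcongr
    _ = 1 := inv_mul_cancel₀ (Real.exp_ne_zero _)

/-- The Taylor series at `ψ` of the function with coefficients `u`. -/
def wSeries {r : ℝ} (hr : 0 < r) (ψ : Fin d → ℝ) (u : CoeffSpace d) :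
    FormalMultilinearSeries ℝ (Fin d → ℝ) ℂ :=
  fun k => lpLift _ _ (norm_wexp_smul_expTerm_le hr ψ k) u

theorem wexp_add (r : ℝ) (ψ h : Fin d → ℝ) (ν : Fin d → ℤ) :
    wexp r (ψ + h) ν = wexp r ψ ν * Complex.exp (Complex.I * (freqDot h ν : ℂ)) := by
  rw [wexp, wexp, freqDot_add_left, mul_assoc, ← Complex.exp_add]
  push_cast
  rw [mul_add]

theorem hasFPowerSeriesOnBall_wEval {r : ℝ} (hr : 0 < r) (ψ : Fin d → ℝ) (u : CoeffSpace d) :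
    HasFPowerSeriesOnBall (fun ψ => wEval hr.le ψ u) (wSeries hr ψ u) ψ (ENNReal.ofReal r) := by
  refine ⟨?_, by simpa using hr, ?_⟩
  · refine FormalMultilinearSeries.le_radius_of_bound _ ‖u‖ fun k => ?_
    rw [Real.coe_toNNReal _ hr.le]
    have h := (lpLift _ _ (norm_wexp_smul_expTerm_le hr ψ k)).le_of_opNorm_le
      (norm_lpLift_le _ (by positivity)) u
    calc _ ≤ (r ^ k)⁻¹ * ‖u‖ * r ^ k := mul_le_mul_of_nonneg_right h (by positivity)
      _ = ‖u‖ := by field_simp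
  · intro h hh
    have hh' : ‖h‖ < r := by
      rw [Metric.mem_eball, edist_zero_right, ← ofReal_norm,
        ENNReal.ofReal_lt_ofReal_iff hr] at hh
      exact hh
    have hterm : ∀ ν : Fin d → ℤ, HasSum
        (fun k => u ν * wexp r ψ ν * ((Complex.I * (freqDot h ν : ℂ)) ^ k / (k.factorial : ℂ)))
        (u ν * wexp r (ψ + h) ν) := by
      intro ν
      have := (NormedSpace.expSeries_div_hasSum_exp (Complex.I * (freqDot h ν : ℂ))).mul_left
        (u ν * wexp r ψ ν)
      rw [wexp_add, ← mul_assoc, Complex.exp_eq_exp_ℂ]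
      exact this
    have hnorm : ∀ (ν : Fin d → ℤ) (k : ℕ),
        ‖u ν * wexp r ψ ν * ((Complex.I * (freqDot h ν : ℂ)) ^ k / (k.factorial : ℂ))‖ ≤
        ‖u ν‖ * (‖h‖ / r) ^ k := by
      intro ν k
      have h1 := norm_wexp_smul_expTerm_le hr ψ k ν
      have h2 := (wexp r ψ ν • expTerm ν k).le_of_opNorm_le h1 fun _ => h
      rw [Finset.prod_const, Finset.card_univ, Fintype.card_fin,
        smul_apply, expTerm_diag, smul_eq_mul, ← div_eq_inv_mul] at h2
      rw [mul_assoc, norm_mul, div_pow]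
      exact mul_le_mul_of_nonneg_left h2 (norm_nonneg _)
    have hsum : Summable fun p : (Fin d → ℤ) × ℕ => u p.1 * wexp r ψ p.1 *
        ((Complex.I * (freqDot h p.1 : ℂ)) ^ p.2 / (p.2.factorial : ℂ)) := by
      refine Summable.of_norm_bounded (g := fun p : (Fin d → ℤ) × ℕ =>
        ‖u p.1‖ * (‖h‖ / r) ^ p.2) ?_ fun p => hnorm p.1 p.2
      exact (summable_norm_lp_one u).mul_of_nonneg (summable_geometric_of_lt_one (by positivity)
        ((div_lt_one hr).2 hh')) (fun _ => norm_nonneg _) (fun _ => by positivity)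
    -- The double series converges absolutely for `‖h‖ < r`. Summing over `k` inside gives the
    -- exponentials, summing over `ν` inside gives the Taylor terms.
    have htot := (hsum.hasSum.prod_fiberwise hterm).unique
      (hasSum_lpLift (norm_wexp_le hr.le (ψ + h)) u)
    have hswap := (Equiv.prodComm ℕ (Fin d → ℤ)).hasSum_iff.2 hsum.hasSum
    rw [htot] at hswap
    refine hswap.prod_fiberwise fun k => ?_
    have := (hasSum_lpLift (norm_wexp_smul_expTerm_le hr ψ k) u).mapL
      (ContinuousMultilinearMap.apply ℝ (fun _ : Fin k => Fin d → ℝ) ℂ fun _ => h)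
    refine this.congr_fun fun ν => ?_
    change _ = u ν • wexp r ψ ν • expTerm ν k (fun _ => h)
    rw [expTerm_diag, smul_eq_mul, smul_eq_mul, ← mul_assoc]
    rfl

theorem analyticOnNhd_wEval {r : ℝ} (hr : 0 < r) (u : CoeffSpace d) :
    AnalyticOnNhd ℝ (fun ψ => wEval hr.le ψ u) univ := fun ψ _ =>
  (hasFPowerSeriesOnBall_wEval hr ψ u).analyticAt

theorem wexp_periodic (r : ℝ) (ψ : Fin d → ℝ) (n ν : Fin d → ℤ) :
    wexp r (fun i => ψ i + 2 * Real.pi * (n i : ℝ)) ν = wexp r ψ ν := by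
  have e : (fun i => ψ i + 2 * Real.pi * (n i : ℝ)) =
      ψ + fun i => 2 * Real.pi * (n i : ℝ) := rfl
  rw [e, wexp_add]
  have : Complex.I * (freqDot (fun i => 2 * Real.pi * (n i : ℝ)) ν : ℂ) =
      ((∑ i, n i * ν i : ℤ) : ℂ) * (2 * Real.pi * Complex.I) := by
    simp only [freqDot]
    push_cast
    rw [Finset.mul_sum, Finset.sum_mul]
    exact Finset.sum_congr rfl fun i _ => by ring
  rw [this, Complex.exp_int_mul_two_pi_mul_I, mul_one]

theorem torusAnalytic_re_wEval {r : ℝ} (hr : 0 < r) (u : CoeffSpace d) :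
    TorusAnalytic fun ψ => (wEval hr.le ψ u).re := by
  refine ⟨fun ψ hψ => (Complex.reCLM.analyticAt _).comp (analyticOnNhd_wEval hr u ψ hψ),
    fun ψ n => ?_⟩
  simp only [wEval, lpLift_apply, wexp_periodic]

end Analytic

/-! ### Summability of exponential weights over the integer lattice. -/

section Lattice

theorem summable_exp_neg_abs_int {δ : ℝ} (hδ : 0 < δ) :
    Summable fun n : ℤ => Real.exp (-(δ * |(n : ℝ)|)) := by
  have h : Summable fun n : ℕ => Real.exp (-(δ * (n : ℝ))) := by
    have := Real.summable_exp_nat_mul_iff.2 (neg_lt_zero.2 hδ)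
    refine this.congr fun n => ?_
    congr 1; ring
  refine Summable.of_nat_of_neg ?_ ?_ <;> simpa using h

theorem summable_exp_neg_absSum (d : ℕ) {δ : ℝ} (hδ : 0 < δ) :
    Summable fun ν : Fin d → ℤ => Real.exp (-(δ * absSum ν)) := by
  induction d with
  | zero => exact Summable.of_finite
  | succ d ih =>
    rw [← (Fin.consEquiv fun _ => ℤ).summable_iff]
    have := (summable_exp_neg_abs_int hδ).mul_of_nonneg ih (fun _ => Real.exp_nonneg _)
      (fun _ => Real.exp_nonneg _)
    refine this.congr fun p => ?_
    rw [← Real.exp_add]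
    simp [absSum, Fin.sum_univ_succ, Fin.consEquiv]
    ring

end Lattice

/-! ### Fourier coefficients on the torus: translation, conjugation, differentiation. -/

section Fourier

variable {d : ℕ}

/-- The function on the standard torus induced by a function of period `2π`. -/
def torusLift (F : (Fin d → ℝ) → ℝ) (y : UnitAddTorus (Fin d)) : ℂ :=
  (F (fun i => 2 * Real.pi * (AddCircle.equivIco 1 0 (y i) : ℝ)) : ℂ)

theorem torusLift_coe {F : (Fin d → ℝ) → ℝ} (hF : TorusPeriodic F) (x : Fin d → ℝ) :
    torusLift F (fun i => (x i : UnitAddCircle)) = F ((2 * Real.pi) • x) := by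
  unfold torusLift
  rw [← hF ((2 * Real.pi) • x) fun i => -⌊x i⌋]
  congr 2
  ext i
  rw [AddCircle.coe_equivIco_mk_apply, div_one, mul_one, ← Int.self_sub_floor]
  simp only [Pi.smul_apply, smul_eq_mul, Int.cast_neg]
  ring

theorem continuous_torusLift {F : (Fin d → ℝ) → ℝ} (hF : TorusPeriodic F) (hc : Continuous F) :
    Continuous (torusLift F) := by
  have hq : IsOpenQuotientMap (Pi.map fun (_ : Fin d) (x : ℝ) => (x : UnitAddCircle)) :=
    IsOpenQuotientMap.piMap fun _ => QuotientAddGroup.isOpenQuotientMap_mk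
  rw [hq.isQuotientMap.continuous_iff]
  have : torusLift F ∘ (Pi.map fun (_ : Fin d) (x : ℝ) => (x : UnitAddCircle)) =
      fun x => ((F ((2 * Real.pi) • x) : ℝ) : ℂ) := by
    ext x
    exact torusLift_coe hF x
  rw [this]
  fun_prop

theorem mFourier_coe (ν : Fin d → ℤ) (x : Fin d → ℝ) :
    UnitAddTorus.mFourier ν (fun i => (x i : UnitAddCircle)) =
      Complex.exp (Complex.I * (freqDot ((2 * Real.pi) • x) ν : ℂ)) := by
  simp only [UnitAddTorus.mFourier, ContinuousMap.coe_mk, fourier_coe_apply]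
  rw [← Complex.exp_sum]
  congr 1
  simp only [freqDot, Pi.smul_apply, smul_eq_mul]
  push_cast
  rw [Finset.mul_sum]
  exact Finset.sum_congr rfl fun i _ => by ring

open scoped Pointwise in
theorem smul_set_pi_Ioc {c : ℝ} (hc : 0 < c) (a : Fin d → ℝ) :
    c • {x : Fin d → ℝ | ∀ i, x i ∈ Ioc (c⁻¹ * a i) (c⁻¹ * a i + 1)} =
      univ.pi fun i => Ioc (a i) (a i + c) := by
  ext ψ
  rw [mem_smul_set_iff_inv_smul_mem₀ hc.ne']
  simp only [mem_ofPred_eq, mem_univ_pi, Pi.smul_apply, smul_eq_mul, mem_Ioc]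
  refine forall_congr' fun i => and_congr (mul_lt_mul_iff_right₀ (inv_pos.2 hc)) ?_
  have : c⁻¹ * a i + 1 = c⁻¹ * (a i + c) := by field_simp
  rw [this, mul_le_mul_iff_right₀ (inv_pos.2 hc)]

/-- The corner `a` of the fundamental cell is left free so that a translation of the function can be
undone by a translation of the cell. -/
theorem mFourierCoeff_torusLift {F : (Fin d → ℝ) → ℝ} (hF : TorusPeriodic F) (ν : Fin d → ℤ)
    (a : Fin d → ℝ) :
    UnitAddTorus.mFourierCoeff (torusLift F) ν = ((2 * Real.pi) ^ d : ℂ)⁻¹ *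
      ∫ ψ in univ.pi fun i => Ioc (a i) (a i + 2 * Real.pi),
        (F ψ : ℂ) * Complex.exp (-Complex.I * (freqDot ψ ν : ℂ)) := by
  rw [UnitAddTorus.mFourierCoeff_eq_integral _ _ fun i => (2 * Real.pi)⁻¹ * a i,
    ← smul_set_pi_Ioc Real.two_pi_pos]
  have h := Measure.setIntegral_comp_smul_of_pos (volume : Measure (Fin d → ℝ))
    (fun ψ => (F ψ : ℂ) * Complex.exp (-Complex.I * (freqDot ψ ν : ℂ)))
    {x : Fin d → ℝ | ∀ i, x i ∈ Ioc ((2 * Real.pi)⁻¹ * a i) ((2 * Real.pi)⁻¹ * a i + 1)}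
    Real.two_pi_pos
  rw [Module.finrank_fintype_fun_eq_card, Fintype.card_fin] at h
  have e : ((2 * Real.pi) ^ d : ℂ)⁻¹ = (((2 * Real.pi) ^ d)⁻¹ : ℝ) := by push_cast; rfl
  rw [e, ← Complex.real_smul, ← h]
  congr 1
  ext x
  rw [torusLift_coe hF, mFourier_coe, smul_eq_mul, mul_comm, freqDot_neg_right]
  push_cast
  rw [mul_neg, neg_mul]

theorem torusFourierCoeff_eq_mFourierCoeff {F : (Fin d → ℝ) → ℝ} (hF : TorusPeriodic F)
    (ν : Fin d → ℤ) : torusFourierCoeff F ν = UnitAddTorus.mFourierCoeff (torusLift F) ν := by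
  rw [mFourierCoeff_torusLift hF ν 0, torusFourierCoeff]
  congr 1
  refine (setIntegral_congr_set ?_).symm
  simpa using! Measure.univ_pi_Ioc_ae_eq_Icc (μ := fun _ : Fin d => (volume : Measure ℝ))
    (f := 0) (g := fun _ => 2 * Real.pi)

theorem torusFourierCoeff_comp_add {F : (Fin d → ℝ) → ℝ} (hF : TorusPeriodic F)
    (v : Fin d → ℝ) (ν : Fin d → ℤ) :
    torusFourierCoeff (fun ψ => F (ψ + v)) ν =
      Complex.exp (Complex.I * (freqDot v ν : ℂ)) * torusFourierCoeff F ν := by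
  have hF' : TorusPeriodic fun ψ => F (ψ + v) := by
    intro ψ n
    refine Eq.trans ?_ (hF (ψ + v) n)
    dsimp only
    congr 1
    ext i
    simp only [Pi.add_apply]
    ring
  rw [torusFourierCoeff_eq_mFourierCoeff hF, torusFourierCoeff_eq_mFourierCoeff hF',
    mFourierCoeff_torusLift hF ν v, mFourierCoeff_torusLift hF' ν 0, mul_left_comm,
    ← integral_const_mul (Complex.exp (Complex.I * (freqDot v ν : ℂ))),
    ← (measurePreserving_add_right volume v).setIntegral_preimage_emb
      (measurableEmbedding_addRight v) _ (univ.pi fun i => Ioc (v i) (v i + 2 * Real.pi))]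
  have hset : (univ.pi fun i => Ioc ((0 : Fin d → ℝ) i) ((0 : Fin d → ℝ) i + 2 * Real.pi)) =
      (fun ψ : Fin d → ℝ => ψ + v) ⁻¹' univ.pi fun i => Ioc (v i) (v i + 2 * Real.pi) := by
    ext ψ
    simp only [mem_univ_pi, mem_preimage, mem_Ioc, Pi.add_apply, Pi.zero_apply, zero_add]
    refine forall_congr' fun i => ?_
    constructor <;> rintro ⟨h1, h2⟩ <;> constructor <;> linarith
  rw [hset]
  congr 1
  refine integral_congr_ae (Eventually.of_forall fun ψ => ?_)
  dsimp only
  rw [mul_left_comm, ← Complex.exp_add, freqDot_add_left]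
  congr 2
  push_cast
  ring

theorem conj_torusFourierCoeff (F : (Fin d → ℝ) → ℝ) (ν : Fin d → ℤ) :
    conj (torusFourierCoeff F ν) = torusFourierCoeff F (-ν) := by
  rw [torusFourierCoeff, torusFourierCoeff, map_mul, ← integral_conj]
  congr 1
  · simp [map_ofNat]
  · congr 1
    ext ψ
    simp [← Complex.exp_conj, freqDot_neg_right]

theorem norm_torusFourierCoeff_le {F : (Fin d → ℝ) → ℝ} {B : ℝ}
    (hB : ∀ ψ ∈ Icc (0 : Fin d → ℝ) (fun _ => 2 * Real.pi), |F ψ| ≤ B) (ν : Fin d → ℤ) :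
    ‖torusFourierCoeff F ν‖ ≤ B := by
  have hvol : volume.real (Icc (0 : Fin d → ℝ) (fun _ => 2 * Real.pi)) = (2 * Real.pi) ^ d := by
    rw [Measure.real, Real.volume_Icc_pi_toReal (a := (0 : Fin d → ℝ)) (fun _ => Real.two_pi_pos.le)]
    simp
  have h := norm_setIntegral_le_of_norm_le_const
    (μ := volume) (s := Icc (0 : Fin d → ℝ) (fun _ => 2 * Real.pi))
    (f := fun ψ => (F ψ : ℂ) * Complex.exp (-Complex.I * (freqDot ψ ν : ℂ))) (C := B)
    isCompact_Icc.measure_lt_top (fun ψ hψ => by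
      have e : -Complex.I * (freqDot ψ ν : ℂ) = Complex.I * ((-freqDot ψ ν : ℝ) : ℂ) := by
        push_cast; ring
      rw [norm_mul, e, norm_cexp_I_mul, mul_one, Complex.norm_real]
      exact hB ψ hψ)
  rw [hvol] at h
  have hp : (0 : ℝ) < (2 * Real.pi) ^ d := by positivity
  rw [torusFourierCoeff, norm_mul, norm_inv]
  have e : ‖((2 * Real.pi) ^ d : ℂ)‖ = (2 * Real.pi) ^ d := by
    rw [norm_pow, norm_mul, Complex.norm_real, Complex.norm_ofNat, Real.norm_eq_abs,
      abs_of_pos Real.pi_pos]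
  rw [e, inv_mul_le_iff₀ hp, mul_comm _ B]
  exact h

/-- Instead of integrating by parts, the coefficient of the translate by `s • v` is differentiated
at `s = 0` in two ways: through the translation formula and under the integral sign. -/
theorem torusFourierCoeff_deriv {F G : (Fin d → ℝ) → ℝ} (hF : TorusPeriodic F)
    (hFc : Continuous F) (hGc : Continuous G) (v : Fin d → ℝ)
    (hd : ∀ ψ (s : ℝ), HasDerivAt (fun s : ℝ => F (ψ + s • v)) (G (ψ + s • v)) s) (ν : Fin d → ℤ) :
    torusFourierCoeff G ν = Complex.I * (freqDot v ν : ℂ) * torusFourierCoeff F ν := by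
  have h1 : HasDerivAt (fun s : ℝ => torusFourierCoeff (fun ψ => F (ψ + s • v)) ν)
      (Complex.I * (freqDot v ν : ℂ) * torusFourierCoeff F ν) 0 := by
    have e : (fun s : ℝ => torusFourierCoeff (fun ψ => F (ψ + s • v)) ν) =
        fun s : ℝ => Complex.exp (Complex.I * ((s * freqDot v ν : ℝ) : ℂ)) *
          torusFourierCoeff F ν := by
      ext s
      rw [torusFourierCoeff_comp_add hF, freqDot_smul_left]
    rw [e]
    have h := (((((hasDerivAt_id (0 : ℝ)).mul_const (freqDot v ν)).ofReal_comp).const_mul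
      Complex.I).cexp).mul_const (torusFourierCoeff F ν)
    simpa using h
  have h2 : HasDerivAt (fun s : ℝ => torusFourierCoeff (fun ψ => F (ψ + s • v)) ν)
      (torusFourierCoeff G ν) 0 := by
    obtain ⟨B, hB⟩ : ∃ B, ∀ p ∈ Icc (0 : Fin d → ℝ) (fun _ => 2 * Real.pi) ×ˢ
        Metric.closedBall (0 : ℝ) 1, |G (p.1 + p.2 • v)| ≤ B := by
      obtain ⟨B, hB⟩ := (isCompact_Icc.prod (isCompact_closedBall (0 : ℝ) 1)).exists_bound_of_continuousOn
        (f := fun p : (Fin d → ℝ) × ℝ => G (p.1 + p.2 • v)) (by fun_prop)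
      exact ⟨B, hB⟩
    unfold torusFourierCoeff
    refine HasDerivAt.const_mul _ ?_
    have hfc : ∀ ψ : Fin d → ℝ, Complex.exp (-Complex.I * (freqDot ψ ν : ℂ)) =
      Complex.exp (-Complex.I * ((∑ i, ψ i * (ν i : ℝ) : ℝ) : ℂ)) := fun ψ => rfl
    have h := hasDerivAt_integral_of_dominated_loc_of_deriv_le
      (μ := volume.restrict (Icc (0 : Fin d → ℝ) (fun _ => 2 * Real.pi))) (𝕜 := ℝ)
      (F := fun (s : ℝ) ψ => (F (ψ + s • v) : ℂ) * Complex.exp (-Complex.I * (freqDot ψ ν : ℂ)))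
      (F' := fun (s : ℝ) ψ => (G (ψ + s • v) : ℂ) * Complex.exp (-Complex.I * (freqDot ψ ν : ℂ)))
      (x₀ := (0 : ℝ)) (bound := fun _ => B) (s := Metric.ball 0 1)
      (Metric.ball_mem_nhds _ one_pos) ?_ ?_ ?_ ?_ ?_ ?_
    · simpa using h.2
    · refine Eventually.of_forall fun s => Continuous.aestronglyMeasurable ?_
      simp only [hfc]
      fun_prop
    · refine Continuous.integrableOn_Icc ?_
      simp only [hfc]
      fun_prop
    · refine Continuous.aestronglyMeasurable ?_
      simp only [hfc]
      fun_prop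
    · filter_upwards [ae_restrict_mem measurableSet_Icc] with ψ hψ s hs
      have e : -Complex.I * (freqDot ψ ν : ℂ) = Complex.I * ((-freqDot ψ ν : ℝ) : ℂ) := by
        push_cast; ring
      rw [norm_mul, e, norm_cexp_I_mul, mul_one, Complex.norm_real]
      exact hB (ψ, s) ⟨hψ, Metric.ball_subset_closedBall hs⟩
    · exact integrableOn_const (by exact isCompact_Icc.measure_lt_top.ne)
    · refine Eventually.of_forall fun ψ s _ => ?_
      exact (hd ψ s).ofReal_comp.mul_const _
  exact h2.unique h1

end Fourier

/-! ### Cauchy-type estimates for real analytic functions. -/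

section Decay

variable {E : Type*} [NormedAddCommGroup E] [NormedSpace ℝ E]

/-- On the diagonal the `k`-th derivative at `y` is `k!` times the `k`-th term of the power series
recentred at `y`. All these recentred series, for `y` within `ρ / 2` of `x`, are dominated by one
convergent double series. -/
theorem exists_nhds_iteratedFDeriv_bound {f : E → ℝ} {x : E} (hf : AnalyticAt ℝ f x) :
    ∃ U ∈ 𝓝 x, ∃ C R : ℝ, 0 < R ∧ 0 ≤ C ∧ ∀ y ∈ U, ∀ (k : ℕ) (e : E), ‖e‖ ≤ 1 →
      |iteratedFDeriv ℝ k f y fun _ => e| ≤ C * k.factorial * (R ^ k)⁻¹ := by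
  obtain ⟨p, r, hp⟩ := hf
  obtain ⟨ρ, hρ0, hρ⟩ := ENNReal.lt_iff_exists_nnreal_btwn.1 hp.r_pos
  have hρ0' : 0 < ρ := by exact_mod_cast hρ0
  have hsum := p.changeOriginSeries_summable_aux₁ (r := ρ / 2) (r' := ρ / 2) (by
    rw [← ENNReal.coe_add, add_halves]
    exact hρ.trans_le hp.r_le)
  refine ⟨Metric.ball x (ρ / 2), Metric.ball_mem_nhds _ (by positivity),
    ((∑' s : Σ k l : ℕ, { s : Finset (Fin (k + l)) // s.card = l },
      ‖p (s.1 + s.2.1)‖₊ * (ρ / 2) ^ s.2.1 * (ρ / 2) ^ s.1 : NNReal) : ℝ), ρ / 2,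
    by positivity, NNReal.coe_nonneg _, fun y hy k e he => ?_⟩
  obtain ⟨h, rfl⟩ : ∃ h, y = x + h := ⟨y - x, by abel⟩
  have hh : ‖h‖₊ ≤ ρ / 2 := by
    rw [mem_ball_iff_norm, add_sub_cancel_left] at hy
    exact_mod_cast hy.le
  have hlt : (‖h‖₊ : ENNReal) < r := by
    refine lt_of_le_of_lt ?_ hρ
    have := hh.trans (NNReal.half_le_self ρ)
    exact_mod_cast this
  have hco := hp.changeOrigin hlt
  rw [← hco.factorial_smul e k, nsmul_eq_mul, abs_mul, Nat.abs_cast]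
  have h1 : ‖p.changeOrigin h k‖₊ * (ρ / 2) ^ k ≤
      ∑' s : Σ k l : ℕ, { s : Finset (Fin (k + l)) // s.card = l },
      ‖p (s.1 + s.2.1)‖₊ * (ρ / 2) ^ s.2.1 * (ρ / 2) ^ s.1 := by
    have h2 := p.nnnorm_changeOrigin_le k (hlt.trans_le hp.r_le)
    have hs := NNReal.summable_sigma.1 hsum
    have hρk : (ρ / 2) ^ k ≠ 0 := by positivity
    have hsk : Summable fun s : Σ l : ℕ, { s : Finset (Fin (k + l)) // s.card = l } =>
        ‖p (k + s.1)‖₊ * (ρ / 2) ^ s.1 := (summable_mul_right_iff hρk).1 (hs.1 k)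
    calc _ ≤ (∑' s : Σ l : ℕ, { s : Finset (Fin (k + l)) // s.card = l },
          ‖p (k + s.1)‖₊ * (ρ / 2) ^ s.1) * (ρ / 2) ^ k := by
          refine mul_le_mul_left (h2.trans ?_) _
          refine Summable.tsum_le_tsum (fun s => ?_) ?_ hsk
          · gcongr
          · refine NNReal.summable_of_le (fun s => ?_) hsk
            gcongr
      _ = ∑' s : Σ l : ℕ, { s : Finset (Fin (k + l)) // s.card = l },
          ‖p (k + s.1)‖₊ * (ρ / 2) ^ s.1 * (ρ / 2) ^ k := (NNReal.tsum_mul_right _ _).symm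
      _ ≤ ∑' k : ℕ, ∑' s : Σ l : ℕ, { s : Finset (Fin (k + l)) // s.card = l },
          ‖p (k + s.1)‖₊ * (ρ / 2) ^ s.1 * (ρ / 2) ^ k := hs.2.le_tsum k (fun _ _ => zero_le)
      _ = _ := (hsum.tsum_sigma' hs.1).symm
  have h2 := (p.changeOrigin h k).le_opNorm fun _ => e
  have h3 : ‖p.changeOrigin h k fun _ => e‖ ≤ ‖p.changeOrigin h k‖ := by
    refine h2.trans (mul_le_of_le_one_right (norm_nonneg _) ?_)
    exact Finset.prod_le_one (fun _ _ => norm_nonneg _) fun _ _ => he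
  have h4 : ‖p.changeOrigin h k‖ * ((ρ : ℝ) / 2) ^ k ≤
      ((∑' s : Σ k l : ℕ, { s : Finset (Fin (k + l)) // s.card = l },
      ‖p (s.1 + s.2.1)‖₊ * (ρ / 2) ^ s.2.1 * (ρ / 2) ^ s.1 : NNReal) : ℝ) := by
    exact_mod_cast h1
  have hpos : (0 : ℝ) < ((ρ : ℝ) / 2) ^ k := by positivity
  have h5 := h3.trans ((le_div_iff₀ hpos).2 h4)
  rw [Real.norm_eq_abs] at h5
  calc _ ≤ (k.factorial : ℝ) * _ := mul_le_mul_of_nonneg_left h5 (Nat.cast_nonneg _)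
    _ = _ := by rw [div_eq_mul_inv]; ring

theorem exists_iteratedFDeriv_bound {f : E → ℝ} (hf : AnalyticOnNhd ℝ f univ) {K : Set E}
    (hK : IsCompact K) :
    ∃ C R : ℝ, 0 < R ∧ 0 ≤ C ∧ ∀ y ∈ K, ∀ (k : ℕ) (e : E), ‖e‖ ≤ 1 →
      |iteratedFDeriv ℝ k f y fun _ => e| ≤ C * k.factorial * (R ^ k)⁻¹ := by
  refine hK.induction_on (p := fun K => ∃ C R : ℝ, 0 < R ∧ 0 ≤ C ∧ ∀ y ∈ K, ∀ (k : ℕ) (e : E),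
    ‖e‖ ≤ 1 → |iteratedFDeriv ℝ k f y fun _ => e| ≤ C * k.factorial * (R ^ k)⁻¹) ?_ ?_ ?_ ?_
  · exact ⟨0, 1, one_pos, le_rfl, fun y hy => hy.elim⟩
  · rintro s t hst ⟨C, R, hR, hC, h⟩
    exact ⟨C, R, hR, hC, fun y hy => h y (hst hy)⟩
  · rintro s t ⟨C, R, hR, hC, h⟩ ⟨C', R', hR', hC', h'⟩
    refine ⟨max C C', min R R', lt_min hR hR', hC.trans (le_max_left _ _), fun y hy k e he => ?_⟩
    have hm : 0 < min R R' := lt_min hR hR'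
    rcases hy with hy | hy
    · refine (h y hy k e he).trans ?_
      gcongr
      · exact le_max_left _ _
      · exact min_le_left _ _
    · refine (h' y hy k e he).trans ?_
      gcongr
      · exact le_max_right _ _
      · exact min_le_right _ _
  · intro x _
    obtain ⟨U, hU, h⟩ := exists_nhds_iteratedFDeriv_bound (hf x (mem_univ x))
    exact ⟨U, mem_nhdsWithin_of_mem_nhds hU, h⟩

end Decay

/-! ### Exponential decay of the Fourier coefficients of an analytic function. -/

section FourierDecay

variable {d : ℕ}

theorem torusFourierCoeff_iteratedFDeriv {f : (Fin d → ℝ) → ℝ} (hf : TorusAnalytic f)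
    (e : Fin d → ℝ) (ν : Fin d → ℤ) (k : ℕ) :
    torusFourierCoeff (fun ψ => iteratedFDeriv ℝ k f ψ fun _ => e) ν =
      (Complex.I * (freqDot e ν : ℂ)) ^ k * torusFourierCoeff f ν := by
  have hcd : ContDiff ℝ ⊤ f := hf.1.contDiff
  induction k with
  | zero => simp
  | succ k ih =>
    rw [pow_succ', mul_assoc, ← ih]
    refine torusFourierCoeff_deriv ?_ ?_ ?_ e ?_ ν
    · intro ψ n
      have hv : (fun ψ => f (ψ + fun i => 2 * Real.pi * (n i : ℝ))) = f :=
        funext fun ψ => hf.2 ψ n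
      have := iteratedFDeriv_comp_add_right (𝕜 := ℝ) (f := f) k
        (fun i => 2 * Real.pi * (n i : ℝ)) ψ
      rw [hv] at this
      simp only [this]
      rfl
    · have := hcd.continuous_iteratedFDeriv (m := k) le_top
      fun_prop
    · have := hcd.continuous_iteratedFDeriv (m := k + 1) le_top
      fun_prop
    · intro ψ s
      have hdiff := (hcd.differentiable_iteratedFDeriv (m := k) (by exact_mod_cast WithTop.coe_lt_top _)) (ψ + s • e)
      have hline : HasDerivAt (fun s : ℝ => ψ + s • e) e s := by
        simpa using ((hasDerivAt_id s).smul_const e).const_add ψ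
      have h1 := hdiff.hasFDerivAt.comp_hasDerivAt s hline
      have h2 := ((ContinuousMultilinearMap.apply ℝ (fun _ : Fin k => Fin d → ℝ) ℝ
        fun _ => e).hasFDerivAt).comp_hasDerivAt s h1
      refine h2.congr_deriv ?_
      rw [iteratedFDeriv_succ_apply_left]
      rfl

/-- The bounds of all orders `k` are summed against `(R / 2) ^ k / k!`: the factorials cancel and a
geometric series of ratio `1 / 2` remains. -/
theorem exists_torusFourierCoeff_decay {f : (Fin d → ℝ) → ℝ} (hf : TorusAnalytic f) :
    ∃ C R : ℝ, 0 < R ∧ ∀ ν, ‖torusFourierCoeff f ν‖ ≤ C * Real.exp (-(R * absSum ν)) := by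
  obtain ⟨C, R, hR, hC, h⟩ := exists_iteratedFDeriv_bound hf.1
    (isCompact_Icc (a := (0 : Fin d → ℝ)) (b := fun _ => 2 * Real.pi))
  have hk : ∀ (ν : Fin d → ℤ) (e : Fin d → ℝ), ‖e‖ ≤ 1 → ∀ k : ℕ,
      |freqDot e ν| ^ k * ‖torusFourierCoeff f ν‖ ≤ C * k.factorial * (R ^ k)⁻¹ := by
    intro ν e he k
    have h1 := norm_torusFourierCoeff_le (ν := ν) fun ψ hψ => h ψ hψ k e he
    rw [torusFourierCoeff_iteratedFDeriv hf] at h1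
    simpa using h1
  have hexp : ∀ (ν : Fin d → ℤ) (e : Fin d → ℝ), ‖e‖ ≤ 1 →
      ‖torusFourierCoeff f ν‖ * Real.exp (R / 2 * |freqDot e ν|) ≤ 2 * C := by
    intro ν e he
    have hs := (NormedSpace.expSeries_div_hasSum_exp (R / 2 * |freqDot e ν|)).mul_left
      ‖torusFourierCoeff f ν‖
    rw [← Real.exp_eq_exp_ℝ] at hs
    have hg : HasSum (fun k : ℕ => C * (1 / 2 : ℝ) ^ k) (C * 2) := hasSum_geometric_two.mul_left C
    rw [mul_comm 2 C]
    refine hasSum_le (fun k => ?_) hs hg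
    have h1 := hk ν e he k
    have hfac : (0 : ℝ) < k.factorial := by exact_mod_cast k.factorial_pos
    have hRk : 0 < R ^ k := by positivity
    rw [mul_pow, div_pow, div_pow, one_pow]
    have e1 : ‖torusFourierCoeff f ν‖ * (R ^ k / 2 ^ k * |freqDot e ν| ^ k / k.factorial) =
        (|freqDot e ν| ^ k * ‖torusFourierCoeff f ν‖) * (R ^ k / 2 ^ k / k.factorial) := by ring
    have e2 : C * k.factorial * (R ^ k)⁻¹ * (R ^ k / 2 ^ k / k.factorial) = C * (1 / 2 ^ k) := by
      field_simp
    rw [e1, ← e2]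
    gcongr
  -- For `d > 0` the direction `e` below is the coordinate vector of the largest `|ν i|`, which
  -- loses a factor `d`; `d + 1` avoids a division by zero when `d = 0`.
  refine ⟨2 * C, R / 2 / (d + 1), by positivity, fun ν => ?_⟩
  obtain ⟨e, he, hle⟩ : ∃ e : Fin d → ℝ, ‖e‖ ≤ 1 ∧ absSum ν ≤ (d + 1) * |freqDot e ν| := by
    rcases isEmpty_or_nonempty (Fin d) with hd | hd
    · exact ⟨0, by simp, by simp [absSum, freqDot]⟩
    · obtain ⟨i, hi⟩ := exists_eq_ciSup_of_finite (f := fun i => |(ν i : ℝ)|)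
      refine ⟨Pi.single i 1, by simp [Pi.norm_single], ?_⟩
      have h1 : freqDot (Pi.single i 1) ν = ν i := by
        simp [freqDot, Pi.single_apply]
      rw [h1]
      have h2 : absSum ν ≤ ∑ _j : Fin d, |(ν i : ℝ)| :=
        Finset.sum_le_sum fun j _ => by
          rw [show |(ν i : ℝ)| = _ from hi]
          exact le_ciSup (f := fun i => |(ν i : ℝ)|) (Set.finite_range _).bddAbove j
      rw [Finset.sum_const, Finset.card_univ, Fintype.card_fin, nsmul_eq_mul] at h2
      have := abs_nonneg (ν i : ℝ)
      linarith
  have h1 := hexp ν e he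
  rw [Real.exp_neg, ← div_eq_mul_inv, le_div_iff₀ (Real.exp_pos _)]
  refine le_trans (mul_le_mul_of_nonneg_left (Real.exp_le_exp.2 ?_) (norm_nonneg _)) h1
  have : R / 2 / (d + 1) * absSum ν ≤ R / 2 / (d + 1) * ((d + 1) * |freqDot e ν|) := by gcongr
  refine this.trans (le_of_eq ?_)
  field_simp

theorem exists_summable_torusFourierCoeff {f : (Fin d → ℝ) → ℝ} (hf : TorusAnalytic f) :
    ∃ r > 0, Summable fun ν => ‖torusFourierCoeff f ν‖ * Real.exp (r * absSum ν) := by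
  obtain ⟨C, R, hR, h⟩ := exists_torusFourierCoeff_decay hf
  refine ⟨R / 2, by positivity, ?_⟩
  refine Summable.of_nonneg_of_le (fun _ => by positivity) (fun ν => ?_)
    ((summable_exp_neg_absSum d (half_pos hR)).mul_left C)
  calc _ ≤ C * Real.exp (-(R * absSum ν)) * Real.exp (R / 2 * absSum ν) := by
        gcongr; exact h ν
    _ = _ := by rw [mul_assoc, ← Real.exp_add]; congr 2; ring

theorem hasSum_torusFourierCoeff {f : (Fin d → ℝ) → ℝ} (hf : TorusPeriodic f) (hc : Continuous f)
    (hs : Summable fun ν => torusFourierCoeff f ν) (ψ : Fin d → ℝ) :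
    HasSum (fun ν => torusFourierCoeff f ν * Complex.exp (Complex.I * (freqDot ψ ν : ℂ))) (f ψ) := by
  have hs' : Summable (UnitAddTorus.mFourierCoeff (⟨torusLift f, continuous_torusLift hf hc⟩ :
      C(UnitAddTorus (Fin d), ℂ))) :=
    hs.congr fun ν => torusFourierCoeff_eq_mFourierCoeff hf ν
  have h := UnitAddTorus.hasSum_mFourier_series_apply_of_summable hs'
    (fun i => (((2 * Real.pi)⁻¹ • ψ) i : UnitAddCircle))
  have e : (2 * Real.pi) • (2 * Real.pi)⁻¹ • ψ = ψ := smul_inv_smul₀ Real.two_pi_pos.ne' ψ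
  simp only [mFourier_coe, ContinuousMap.coe_mk, torusLift_coe hf, e] at h
  refine h.congr_fun fun ν => ?_
  rw [torusFourierCoeff_eq_mFourierCoeff hf, smul_eq_mul]

end FourierDecay

/-! ### Expansion of `g` at `c₀`. -/

section Taylor

/-- The Taylor expansion of an analytic function with the first two terms split off. -/
theorem exists_taylor_remainder {g : ℝ → ℝ} {c₀ : ℝ} (hg : AnalyticAt ℝ g c₀) :
    ∃ (c : ℕ → ℝ) (δ₀ : ℝ), 0 < δ₀ ∧ (Summable fun k : ℕ => |c k| * (k + 2) * δ₀ ^ k) ∧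
      ∀ x, |x| ≤ δ₀ → HasSum (fun k => c k * x ^ (k + 2)) (g (c₀ + x) - g c₀ - deriv g c₀ * x) := by
  obtain ⟨p, r, hp⟩ := hg
  obtain ⟨s, hs0, hs⟩ := ENNReal.lt_iff_exists_nnreal_btwn.1 hp.r_pos
  have hs0' : (0 : ℝ) < s := by exact_mod_cast hs0
  obtain ⟨C, hC, hbound⟩ := p.norm_mul_pow_le_of_lt_radius (hs.trans_le hp.r_le)
  -- Half of a radius with bounded terms leaves a factor `2 ^ (-k)`, enough to absorb the weight `k
  -- + 2` of the Lipschitz constant.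
  refine ⟨fun k => p.coeff (k + 2), s / 2, by positivity, ?_, fun x hx => ?_⟩
  · have h1 : Summable fun k : ℕ => ((k : ℝ) ^ 1 * (1 / 2 : ℝ) ^ k + 2 * (1 / 2 : ℝ) ^ k) :=
      (summable_pow_mul_geometric_of_norm_lt_one 1 (by norm_num)).add
        (summable_geometric_two.mul_left 2)
    refine Summable.of_nonneg_of_le (fun k => by positivity) (fun k => ?_)
      (h1.mul_left (C / s ^ 2))
    have h2 := hbound (k + 2)
    rw [FormalMultilinearSeries.norm_apply_eq_norm_coef, Real.norm_eq_abs] at h2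
    have h3 : |p.coeff (k + 2)| * (s : ℝ) ^ k ≤ C / s ^ 2 := by
      rw [le_div_iff₀ (by positivity), mul_assoc, ← pow_add]
      exact h2
    calc _ = |p.coeff (k + 2)| * (s : ℝ) ^ k * ((k + 2) * (1 / 2) ^ k) := by
          rw [div_pow, one_div, inv_pow]; ring
      _ ≤ C / s ^ 2 * ((k + 2) * (1 / 2) ^ k) := by gcongr
      _ = _ := by ring
  · have hx' : x ∈ Metric.eball (0 : ℝ) r := by
      rw [Metric.mem_eball, edist_zero_right]
      refine lt_of_le_of_lt ?_ hs
      rw [← enorm_norm, ← ofReal_norm, norm_norm, Real.norm_eq_abs]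
      refine ENNReal.ofReal_le_of_le_toReal ?_
      rw [ENNReal.coe_toReal]
      linarith
    have h := hp.hasSum hx'
    have h' := (hasSum_nat_add_iff' 2).2 h
    have h0 : p.coeff 0 = g c₀ := by
      rw [FormalMultilinearSeries.coeff, hp.coeff_zero]
    have h1 : p.coeff 1 = deriv g c₀ := by
      rw [hp.hasFPowerSeriesAt.deriv]; rfl
    simp only [FormalMultilinearSeries.apply_eq_pow_smul_coeff, smul_eq_mul,
      Finset.sum_range_succ, Finset.sum_range_zero, h0, h1] at h'
    have e : g (c₀ + x) - g c₀ - deriv g c₀ * x =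
        g (c₀ + x) - (0 + x ^ 0 * g c₀ + x ^ 1 * deriv g c₀) := by ring
    rw [e]
    exact h'.congr_fun fun k => mul_comm _ _

end Taylor

/-! ### The oscillating part of the forcing. -/

section Forcing

variable {d : ℕ}

/-- The weighted Fourier coefficients of the oscillating part of `t ↦ f (ω t)`. -/
def forcingCoeff {f : (Fin d → ℝ) → ℝ} (ω : Fin d → ℝ) {r : ℝ}
    (hs : Summable fun ν => ‖torusFourierCoeff f ν‖ * Real.exp (r * absSum ν)) : CoeffSpace d :=
  ⟨fun ν => if freqDot ω ν = 0 then 0 else torusFourierCoeff f ν * Real.exp (r * absSum ν), by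
    refine memℓp_gen ?_
    simp only [ENNReal.toReal_one, Real.rpow_one]
    refine Summable.of_nonneg_of_le (fun _ => norm_nonneg _) (fun ν => ?_) hs
    split_ifs
    · rw [norm_zero]; positivity
    · rw [norm_mul, Complex.norm_real, Real.norm_eq_abs, Real.abs_exp]⟩

variable {f : (Fin d → ℝ) → ℝ} (ω : Fin d → ℝ) {r : ℝ}
  (hs : Summable fun ν => ‖torusFourierCoeff f ν‖ * Real.exp (r * absSum ν))

theorem forcingCoeff_apply (ν : Fin d → ℤ) : forcingCoeff ω hs ν =
    if freqDot ω ν = 0 then 0 else torusFourierCoeff f ν * Real.exp (r * absSum ν) := rfl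

theorem wRefl_forcingCoeff : wRefl (forcingCoeff ω hs) = forcingCoeff ω hs := by
  ext ν
  have h0 : freqDot ω (-ν) = 0 ↔ freqDot ω ν = 0 := by rw [freqDot_neg_right, neg_eq_zero]
  rw [wRefl_apply, forcingCoeff_apply, forcingCoeff_apply]
  by_cases hν : freqDot ω ν = 0
  · rw [if_pos hν, if_pos (h0.2 hν), map_zero]
  · rw [if_neg hν, if_neg (mt h0.1 hν), map_mul, conj_torusFourierCoeff, neg_neg, Complex.conj_ofReal, absSum_neg]

/-- Along `t ↦ t • ω` the modes with `ω·ν = 0` are constant, so dropping them subtracts exactly the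
mean value. -/
theorem re_wEval_forcingCoeff (hr : 0 ≤ r) (hf : TorusAnalytic f) (t : ℝ) :
    (wEval hr (t • ω) (forcingCoeff ω hs)).re = f (t • ω) - meanValue f ω := by
  have hs1 : Summable fun ν => torusFourierCoeff f ν := by
    refine Summable.of_norm_bounded hs fun ν => ?_
    exact le_mul_of_one_le_right (norm_nonneg _)
      (Real.one_le_exp (mul_nonneg hr (absSum_nonneg ν)))
  have h1 := hasSum_torusFourierCoeff hf.2 hf.1.continuous hs1 (t • ω)
  have h2 : HasSum _ (wEval hr (t • ω) (forcingCoeff ω hs)) :=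
    hasSum_lpLift (norm_wexp_le hr (t • ω)) (forcingCoeff ω hs)
  have h3 : HasSum ({ν : Fin d → ℤ | freqDot ω ν = 0}.indicator fun ν => torusFourierCoeff f ν)
      (∑' ν : {ν : Fin d → ℤ // freqDot ω ν = 0}, torusFourierCoeff f ν.1) :=
    (hasSum_subtype_iff_indicator (s := {ν : Fin d → ℤ | freqDot ω ν = 0})).1
      (hs1.subtype _).hasSum
  have h4 := (h3.add h2).unique (h1.congr_fun fun ν => ?_)
  · have := congrArg Complex.re h4
    rw [Complex.add_re, Complex.ofReal_re] at this
    rw [meanValue]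
    linarith
  · rw [forcingCoeff_apply, wexp, freqDot_smul_left]
    by_cases hν : freqDot ω ν = 0
    · rw [indicator_of_mem (by exact hν), if_pos hν, hν]
      simp
    · rw [indicator_of_notMem (by exact hν), if_neg hν, zero_add, smul_eq_mul, mul_assoc,
        ← mul_assoc (Real.exp (r * absSum ν) : ℂ), ← Complex.ofReal_mul, ← Real.exp_add]
      simp

end Forcing

/-! ### Existence of the response solution. -/

section Existence

variable {d : ℕ}

/-- Here `h` stands for `φ - N u`. The symbol stays bounded after multiplication by `i w` and by `(i
w)²`, so `u` has two time derivatives and the equation can be checked mode by mode. The factor `|ε|`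
in the velocity bound comes from `norm_mul_respSymbol_le`. -/
theorem responseMotion_isSolutionOn {g : ℝ → ℝ} {f : (Fin d → ℝ) → ℝ} {ω : Fin d → ℝ} {c₀ a ε : ℝ}
    (ha : a ≠ 0) (hε : |ε| ≤ 1) {r : ℝ} (hr : 0 ≤ r) {u h : CoeffSpace d}
    (hu : u = wMultiplier (fun ν => respSymbol a ε (freqDot ω ν)) (respBound a)
      (fun ν => norm_respSymbol_le ha hε (freqDot ω ν)) h)
    (heq : ∀ t : ℝ, (wEval hr (t • ω) h).re =
      f (t • ω) - g (c₀ + (wEval hr (t • ω) u).re) + a * (wEval hr (t • ω) u).re) :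
    IsSolutionOn ε g f ω univ (responseMotion c₀ (fun ψ => (wEval hr ψ u).re) ω)
        (deriv (responseMotion c₀ (fun ψ => (wEval hr ψ u).re) ω)) ∧
      ∀ t, |deriv (responseMotion c₀ (fun ψ => (wEval hr ψ u).re) ω) t| ≤ |ε| * ‖h‖ := by
  have hm1 : ∀ ν, ‖Complex.I * (freqDot ω ν : ℂ) * respSymbol a ε (freqDot ω ν)‖ ≤ |ε| := by
    intro ν
    rw [mul_assoc, norm_mul, Complex.norm_I, one_mul]
    exact norm_mul_respSymbol_le a ε _
  have hm2 : ∀ ν, ‖Complex.I * (freqDot ω ν : ℂ) *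
      (Complex.I * (freqDot ω ν : ℂ) * respSymbol a ε (freqDot ω ν))‖ ≤
      1 + |a| * respBound a := by
    intro ν
    have e : Complex.I * (freqDot ω ν : ℂ) *
      (Complex.I * (freqDot ω ν : ℂ) * respSymbol a ε (freqDot ω ν)) =
      -(((freqDot ω ν ^ 2 : ℝ) : ℂ) * respSymbol a ε (freqDot ω ν)) := by
      push_cast
      linear_combination ((freqDot ω ν : ℂ) ^ 2 * respSymbol a ε (freqDot ω ν)) * Complex.I_sq
    rw [e, norm_neg]
    exact norm_sq_mul_respSymbol_le ha hε _
  set v := wMultiplier _ _ hm1 h with hv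
  set w := wMultiplier _ _ hm2 h with hw
  have hd1 : ∀ t : ℝ, HasDerivAt (responseMotion c₀ (fun ψ => (wEval hr ψ u).re) ω)
      (wEval hr (t • ω) v).re t := by
    intro t
    have h1 := hasDerivAt_wEval_wMultiplier
      (fun ν => norm_respSymbol_le ha hε (freqDot ω ν)) hr ω hm1 (fun ν => rfl) h t
    rw [← hu] at h1
    exact (Complex.reCLM.hasFDerivAt.comp_hasDerivAt t h1).const_add c₀
  have hd2 : ∀ t : ℝ, HasDerivAt (fun t : ℝ => (wEval hr (t • ω) v).re)
      (wEval hr (t • ω) w).re t := by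
    intro t
    have h1 := hasDerivAt_wEval_wMultiplier hm1 hr ω hm2 (fun ν => rfl) h t
    exact Complex.reCLM.hasFDerivAt.comp_hasDerivAt t h1
  have hderiv : deriv (responseMotion c₀ (fun ψ => (wEval hr ψ u).re) ω) =
      fun t : ℝ => (wEval hr (t • ω) v).re := funext fun t => (hd1 t).deriv
  rw [hderiv]
  refine ⟨fun t _ => ⟨(hd1 t).hasDerivWithinAt, _, (hd2 t).hasDerivWithinAt, ?_⟩, fun t => ?_⟩
  -- At `ε = 0` the symbol vanishes and the equation only asks for zero velocity.
  · by_cases h0 : ε = 0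
    · have hv0 : v = 0 := by
        ext ν
        rw [hv, wMultiplier_apply, h0, respSymbol_zero]
        simp
      rw [hv0, h0]
      simp
    · have key : (ε : ℂ) * wEval hr (t • ω) w + wEval hr (t • ω) v +
          ε * (a * wEval hr (t • ω) u) = ε * wEval hr (t • ω) h := by
        have e : (ε : ℂ) • w + v + (ε : ℂ) • ((a : ℂ) • u) = (ε : ℂ) • h := by
          ext ν
          have := respSymbol_equation ha h0 (freqDot ω ν)
          simp only [lp.coeFn_add, lp.coeFn_smul, Pi.add_apply, Pi.smul_apply, smul_eq_mul, hu,
            hv, hw, wMultiplier_apply]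
          linear_combination h ν * this
        have := congrArg (wEval hr (t • ω)) e
        simpa only [map_add, map_smul, smul_eq_mul] using this
      have key' := congrArg Complex.re key
      simp only [Complex.add_re, Complex.re_ofReal_mul] at key'
      have := heq t
      simp only [responseMotion]
      rw [this] at key'
      linarith
  · calc _ ≤ ‖wEval hr (t • ω) v‖ := Complex.abs_re_le_norm _
      _ ≤ ‖v‖ := wEval_norm_le hr _ v
      _ ≤ _ := norm_wMultiplier_apply_le hm1 (abs_nonneg ε) h

/-- The size `ρ` is prescribed in advance, so that the response stays in the box where the Lyapunov
estimates hold. -/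
theorem exists_responseMotion {g : ℝ → ℝ} {f : (Fin d → ℝ) → ℝ} {c₀ : ℝ} (hg : AnalyticAt ℝ g c₀)
    (hf : TorusAnalytic f) (ω : Fin d → ℝ) (h0 : g c₀ = meanValue f ω) (h1 : deriv g c₀ ≠ 0)
    {ρ : ℝ} (hρ : 0 < ρ) :
    ∃ ε₀ > 0, ε₀ ≤ 1 ∧ ∃ X : ℝ → (Fin d → ℝ) → ℝ,
      (∀ ε : ℝ, |ε| < ε₀ → TorusAnalytic (X ε) ∧
        IsSolutionOn ε g f ω univ
          (responseMotion c₀ (X ε) ω) (deriv (responseMotion c₀ (X ε) ω)) ∧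
        ∀ t, |responseMotion c₀ (X ε) ω t - c₀| < ρ ∧
          |deriv (responseMotion c₀ (X ε) ω) t| < ρ) ∧
      TendstoUniformly X (fun _ => 0) (𝓝 0) := by
  obtain ⟨r, hr, hs⟩ := exists_summable_torusFourierCoeff hf
  obtain ⟨c, δ₀, hδ₀, hc, hsum⟩ := exists_taylor_remainder hg
  set a := deriv g c₀ with ha
  set φ := forcingCoeff ω hs with hφ
  set K := ∑' k : ℕ, |c k| * (k + 2) * δ₀ ^ k with hK
  have hK0 : 0 ≤ K := tsum_nonneg fun k => by positivity
  have hCb := respBound_nonneg a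
  -- Small enough for contraction constant `1 / 2`, and below `ρ` so that the position stays in the
  -- box.
  obtain ⟨δ, hδ, hδδ₀, hδρ, hCδ⟩ : ∃ δ : ℝ, 0 < δ ∧ δ ≤ δ₀ ∧ δ < ρ ∧
      respBound a * (K * δ) ≤ 1 / 2 := by
    refine ⟨min δ₀ (min (ρ / 2) (1 / (2 * (respBound a * K + 1)))), by positivity,
      min_le_left _ _, ?_, ?_⟩
    · exact ((min_le_right _ _).trans (min_le_left _ _)).trans_lt (by linarith)
    · have h2 : min δ₀ (min (ρ / 2) (1 / (2 * (respBound a * K + 1)))) ≤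
          1 / (2 * (respBound a * K + 1)) := (min_le_right _ _).trans (min_le_right _ _)
      rw [← mul_assoc]
      refine (mul_le_mul_of_nonneg_left h2 (by positivity)).trans ?_
      rw [mul_one_div, div_le_div_iff₀ (by positivity) two_pos]
      linarith
  obtain ⟨ε₁, hε₁, hε₁1, hsmall⟩ := tendsto_norm_wMultiplier_respSymbol h1 ω φ
    (fun ν hν => by rw [hφ, forcingCoeff_apply, if_pos hν]) (half_pos hδ)
  -- A bound for `‖φ - N u‖` on the ball, so that `|ε| < ρ / B` keeps the velocity below `ρ`.
  set B := ‖φ‖ + K * δ * δ + 1 with hB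
  have hB0 : 0 < B := by positivity
  -- The smallness of `ε` stands inside the existential so that `choose` yields a family indexed by
  -- all real `ε`.
  have hex : ∀ ε, ∃ u : CoeffSpace d, |ε| < min ε₁ (ρ / B) → ∃ hε : |ε| ≤ 1,
      wRefl u = u ∧ ‖u‖ ≤ δ ∧
      u = wMultiplier (fun ν => respSymbol a ε (freqDot ω ν)) (respBound a)
        (fun ν => norm_respSymbol_le h1 hε (freqDot ω ν)) (φ - bilinSeries (wConv hr.le) c u) ∧
      ‖u‖ ≤ 2 * ‖wMultiplier (fun ν => respSymbol a ε (freqDot ω ν)) (respBound a)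
        (fun ν => norm_respSymbol_le h1 hε (freqDot ω ν)) φ‖ := by
    intro ε
    by_cases hε : |ε| < min ε₁ (ρ / B)
    swap
    · exact ⟨0, fun h => absurd h hε⟩
    have hε1 : |ε| < ε₁ := hε.trans_le (min_le_left _ _)
    have hε' : |ε| ≤ 1 := hε1.le.trans hε₁1
    obtain ⟨u, huS, hu1, hu2, hu3⟩ := exists_fixedPoint_bilinSeries
      (norm_wConv_apply_le (d := d) hr.le) hc hδ.le hδδ₀
      (wMultiplier (fun ν => respSymbol a ε (freqDot ω ν)) (respBound a)
        (fun ν => norm_respSymbol_le h1 hε' (freqDot ω ν)))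
      (norm_lpLift_le _ hCb) hCδ φ (hsmall ε hε1 _).le (S := {u | wRefl u = u})
      (isClosed_eq continuous_wReflHom continuous_id) (map_zero wReflHom) (by
        intro u hu huδ
        have hu : wRefl u = u := hu
        change wRefl _ = _
        rw [wRefl_wMultiplier _ fun ν => by rw [conj_respSymbol, freqDot_neg_right]]
        congr 1
        have := map_sub wReflHom φ (bilinSeries (wConv hr.le) c u)
        simp only [wReflHom_apply] at this
        rw [this, wRefl_bilinSeries hr.le hc (huδ.trans hδδ₀) hu, hφ, wRefl_forcingCoeff])
    exact ⟨u, fun _ => ⟨hε', huS, hu1, hu2, hu3⟩⟩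
  choose U hU using hex
  refine ⟨min ε₁ (ρ / B), by positivity, (min_le_left _ _).trans hε₁1,
    fun ε ψ => (wEval hr.le ψ (U ε)).re, fun ε hε => ?_, ?_⟩
  · obtain ⟨hε', hre, hu1, hu2, -⟩ := hU ε hε
    have hXle : ∀ ψ, |(wEval hr.le ψ (U ε)).re| ≤ δ := fun ψ =>
      (Complex.abs_re_le_norm _).trans ((wEval_norm_le hr.le ψ _).trans hu1)
    obtain ⟨hsol, hvel⟩ := responseMotion_isSolutionOn (g := g) (f := f) (c₀ := c₀) h1 hε' hr.le hu2
      (fun t => by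
        rw [map_sub, Complex.sub_re, hφ, re_wEval_forcingCoeff ω hs hr.le hf]
        have h2 := hasSum_wEval_bilinSeries hr.le hc (t • ω) (hu1.trans hδδ₀)
        have h3 := hsum _ ((hXle (t • ω)).trans hδδ₀)
        -- Reflection invariance makes the value real, so the series in the algebra is the real
        -- Taylor series of `g`.
        have h4 : wEval hr.le (t • ω) (U ε) = ((wEval hr.le (t • ω) (U ε)).re : ℂ) :=
          (Complex.conj_eq_iff_re.1 (Complex.conj_eq_iff_im.2
            (wEval_im_eq_zero hr.le (t • ω) hre))).symm
        have h5 := Complex.hasSum_re h2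
        have h6 := h5.unique (h3.congr_fun fun k => by
          rw [h4, Complex.re_ofReal_mul, ← Complex.ofReal_pow, Complex.ofReal_re,
            Complex.ofReal_re])
        rw [h6, ← h0]
        ring)
    refine ⟨torusAnalytic_re_wEval hr _, hsol, fun t => ⟨?_, ?_⟩⟩
    · rw [responseMotion, add_sub_cancel_left]
      exact (hXle _).trans_lt hδρ
    · refine (hvel t).trans_lt ?_
      have h2 : ‖φ - bilinSeries (wConv hr.le) c (U ε)‖ ≤ B := by
        have h3 := norm_bilinSeries_sub_le (norm_wConv_apply_le (d := d) hr.le) hc hδδ₀ hu1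
          (v := 0) (by simpa using hδ.le)
        rw [bilinSeries_zero, sub_zero, sub_zero] at h3
        have h4 : K * δ * ‖U ε‖ ≤ K * δ * δ := by gcongr
        have h5 := norm_sub_le φ (bilinSeries (wConv hr.le) c (U ε))
        linarith
      have h3 : |ε| < ρ / B := hε.trans_le (min_le_right _ _)
      rw [lt_div_iff₀ hB0] at h3
      exact (mul_le_mul_of_nonneg_left h2 (abs_nonneg _)).trans_lt h3
  · rw [Metric.tendstoUniformly_iff]
    intro η hη
    obtain ⟨ε₂, hε₂, -, hsmall₂⟩ := tendsto_norm_wMultiplier_respSymbol h1 ω φ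
      (fun ν hν => by rw [hφ, forcingCoeff_apply, if_pos hν]) (half_pos hη)
    have hpos : 0 < min ε₂ (min ε₁ (ρ / B)) := by positivity
    filter_upwards [Metric.ball_mem_nhds (0 : ℝ) hpos] with ε hε ψ
    have hε : |ε| < min ε₂ (min ε₁ (ρ / B)) := by simpa using hε
    obtain ⟨hε', -, -, -, hu⟩ := hU ε (hε.trans_le (min_le_right _ _))
    rw [dist_zero_left, Real.norm_eq_abs]
    have h2 := hsmall₂ ε (hε.trans_le (min_le_left _ _))
      (fun ν => norm_respSymbol_le h1 hε' (freqDot ω ν))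
    have h3 := (Complex.abs_re_le_norm _).trans (wEval_norm_le hr.le ψ (U ε))
    linarith

end Existence

/-! ### The Lyapunov function and its differential inequality. -/

section Lyapunov

/-- The quadratic Lyapunov function of the damped oscillator. -/
def lyapunov (ε ξ η : ℝ) : ℝ := (ξ + ε * η) ^ 2 + (ε * η) ^ 2

theorem lyapunov_nonneg (ε ξ η : ℝ) : 0 ≤ lyapunov ε ξ η := by
  unfold lyapunov; positivity

theorem sq_le_two_mul_lyapunov (ε ξ η : ℝ) : ξ ^ 2 ≤ 2 * lyapunov ε ξ η := by
  unfold lyapunov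
  nlinarith [sq_nonneg (ξ + 2 * (ε * η))]

theorem sq_mul_le_lyapunov (ε ξ η : ℝ) : (ε * η) ^ 2 ≤ lyapunov ε ξ η := by
  unfold lyapunov
  linarith [sq_nonneg (ξ + ε * η)]

theorem lyapunov_le {ε ξ η δ : ℝ} (hε : |ε| ≤ 1) (hξ : |ξ| ≤ δ) (hη : |η| ≤ δ) :
    lyapunov ε ξ η ≤ 5 * δ ^ 2 := by
  have h1 : |ε * η| ≤ δ := by
    rw [abs_mul]
    exact (mul_le_of_le_one_left (abs_nonneg _) hε).trans hη
  have h2 : |ξ + ε * η| ≤ 2 * δ := (abs_add_le _ _).trans (by linarith)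
  have h3 := sq_le_sq' (abs_le.1 h1).1 (abs_le.1 h1).2
  have h4 := sq_le_sq' (abs_le.1 h2).1 (abs_le.1 h2).2
  unfold lyapunov
  linarith

theorem hasDerivWithinAt_lyapunov {ε : ℝ} {x v y w : ℝ → ℝ} {J : Set ℝ} {t x' v' y' w' : ℝ}
    (hx : HasDerivWithinAt x x' J t) (hv : HasDerivWithinAt v v' J t)
    (hy : HasDerivWithinAt y y' J t) (hw : HasDerivWithinAt w w' J t) :
    HasDerivWithinAt (fun t => lyapunov ε (x t - y t) (v t - w t))
      (2 * (x t - y t + ε * (v t - w t)) * (x' - y' + ε * (v' - w')) +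
        2 * (ε * (v t - w t)) * (ε * (v' - w'))) J t := by
  have hη := (hv.sub hw).const_mul ε
  have hz := (hx.sub hy).add hη
  have := (hz.pow 2).add (hη.pow 2)
  refine this.congr_deriv ?_
  simp

/-- When `η = ξ'` and `q = η'`, the variable `ξ + ε η` has derivative `-ε b ξ`, and the cross terms
complete to squares: `ε V' = -2 ε² b (ξ + ε η)² - 2 (1 - ε² b) (ε η)²`. The factor `ε` on the left
makes one inequality serve both signs of `ε`. -/
theorem mul_lyapunov_deriv_le {ε a b ξ η q : ℝ} (hab : a / 2 ≤ b) (hba : b ≤ 2 * a)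
    (ha : 0 ≤ a) (hε : 4 * ε ^ 2 * a ≤ 1) (hq : ε * q = -η - ε * (b * ξ)) :
    ε * (2 * (ξ + ε * η) * (η + ε * q) + 2 * (ε * η) * (ε * q)) ≤
      -(ε ^ 2 * a * lyapunov ε ξ η) := by
  have e : ε * (2 * (ξ + ε * η) * (η + ε * q) + 2 * (ε * η) * (ε * q)) =
      -(2 * ε ^ 2 * b) * (ξ + ε * η) ^ 2 - 2 * (1 - ε ^ 2 * b) * (ε * η) ^ 2 := by
    rw [hq]; ring
  rw [e, lyapunov]
  have h1 : 0 ≤ ε ^ 2 * (2 * b - a) * (ξ + ε * η) ^ 2 :=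
    mul_nonneg (mul_nonneg (sq_nonneg _) (by linarith)) (sq_nonneg _)
  have h2 : 0 ≤ (2 - 2 * (ε ^ 2 * b) - ε ^ 2 * a) * (ε * η) ^ 2 := by
    refine mul_nonneg ?_ (sq_nonneg _)
    have := mul_le_mul_of_nonneg_left hba (sq_nonneg ε)
    have := mul_nonneg (sq_nonneg ε) ha
    linarith
  linarith

/-- `g` has slopes between `a / 2` and `2 a` on the closed interval of radius `R` about `c₀`. -/
def SlopesNear (g : ℝ → ℝ) (c₀ R a : ℝ) : Prop :=
  ∀ x y, |x - c₀| ≤ R → |y - c₀| ≤ R → ∃ b, a / 2 ≤ b ∧ b ≤ 2 * a ∧ g x - g y = b * (x - y)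

/-- Strict differentiability at `c₀` controls the slope between any two nearby points: it lies
within `a / 2` of `a = g'(c₀)`. -/
theorem exists_slopesNear {g : ℝ → ℝ} {c₀ : ℝ} (hg : AnalyticAt ℝ g c₀) (ha : 0 < deriv g c₀) :
    ∃ R > 0, SlopesNear g c₀ R (deriv g c₀) := by
  have h := hg.hasStrictDerivAt.isLittleO
  have h2 := h.def (half_pos ha)
  rw [nhds_prod_eq] at h2
  obtain ⟨U, hU, hUU⟩ := Filter.eventually_prod_self_iff'.1 h2
  obtain ⟨R, hR, hRU⟩ := Metric.eventually_nhds_iff.1 hU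
  refine ⟨R / 2, half_pos hR, fun x y hx hy => ?_⟩
  have hx' : U x := hRU (by rw [Real.dist_eq]; linarith)
  have hy' : U y := hRU (by rw [Real.dist_eq]; linarith)
  have h3 := hUU x hx' y hy'
  rcases eq_or_ne x y with rfl | hxy
  · exact ⟨deriv g c₀, by linarith, by linarith, by simp⟩
  have hne : 0 < |x - y| := abs_pos.2 (sub_ne_zero.2 hxy)
  refine ⟨(g x - g y) / (x - y), ?_, ?_, (div_mul_cancel₀ _ (sub_ne_zero.2 hxy)).symm⟩ <;>
  · have h4 : |(g x - g y) / (x - y) - deriv g c₀| ≤ deriv g c₀ / 2 := by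
      have e : (g x - g y) / (x - y) - deriv g c₀ =
          (g x - g y - (x - y) * deriv g c₀) / (x - y) := by
        have := sub_ne_zero.2 hxy
        field_simp
      rw [e, abs_div, div_le_iff₀ hne]
      simpa using h3
    have := abs_le.1 h4
    linarith

theorem SlopesNear.abs_sub_le {g : ℝ → ℝ} {c₀ R a : ℝ} (h : SlopesNear g c₀ R a) (ha : 0 ≤ a)
    {x y : ℝ} (hx : |x - c₀| ≤ R) (hy : |y - c₀| ≤ R) : |g x - g y| ≤ 2 * a * |x - y| := by
  obtain ⟨b, hb1, hb2, e⟩ := h x y hx hy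
  rw [e, abs_mul, abs_of_nonneg (by linarith)]
  exact mul_le_mul_of_nonneg_right hb2 (abs_nonneg _)

/-- The differential inequality for the Lyapunov function of two motions that satisfy the equation
at the time `t`. -/
theorem exists_hasDerivWithinAt_lyapunov_le {g : ℝ → ℝ} {c₀ R a ε F : ℝ}
    (hs : SlopesNear g c₀ R a) (ha : 0 ≤ a) (hε : 4 * ε ^ 2 * a ≤ 1)
    {x v y w : ℝ → ℝ} {J : Set ℝ} {t α β : ℝ}
    (hx : HasDerivWithinAt x (v t) J t) (hv : HasDerivWithinAt v α J t)
    (hy : HasDerivWithinAt y (w t) J t) (hw : HasDerivWithinAt w β J t)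
    (hxe : ε * α + v t + ε * g (x t) = ε * F) (hye : ε * β + w t + ε * g (y t) = ε * F)
    (hxR : |x t - c₀| ≤ R) (hyR : |y t - c₀| ≤ R) :
    ∃ V', HasDerivWithinAt (fun t => lyapunov ε (x t - y t) (v t - w t)) V' J t ∧
      ε * V' ≤ -(ε ^ 2 * a * lyapunov ε (x t - y t) (v t - w t)) := by
  obtain ⟨b, hb1, hb2, e⟩ := hs _ _ hxR hyR
  refine ⟨_, hasDerivWithinAt_lyapunov hx hv hy hw, mul_lyapunov_deriv_le hb1 hb2 ha hε ?_⟩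
  rw [← e]
  linarith

/-- Integrating factor for `ε V' ≤ -ε² a V`. The outer `ε` leaves its sign open: decay forward in
time for `ε > 0`, backward for `ε < 0`. -/
theorem antitoneOn_mul_exp_mul {ε a : ℝ} {V : ℝ → ℝ} {J : Set ℝ} (hJ : Convex ℝ J)
    (h : ∀ t ∈ J, ∃ V', HasDerivWithinAt V V' J t ∧ ε * V' ≤ -(ε ^ 2 * a * V t)) :
    AntitoneOn (fun t => ε * (Real.exp (ε * a * t) * V t)) J := by
  choose! V' hV' hle using h
  have hd : ∀ t ∈ J, HasDerivWithinAt (fun t => ε * (Real.exp (ε * a * t) * V t))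
      (ε * (Real.exp (ε * a * t) * (ε * a) * V t + Real.exp (ε * a * t) * V' t)) J t := by
    intro t ht
    have h1 : HasDerivAt (fun t => Real.exp (ε * a * t)) (Real.exp (ε * a * t) * (ε * a)) t := by
      simpa using ((hasDerivAt_id t).const_mul (ε * a)).exp
    exact (h1.hasDerivWithinAt.mul (hV' t ht)).const_mul ε
  refine antitoneOn_of_hasDerivWithinAt_nonpos hJ (fun t ht => (hd t ht).continuousWithinAt)
    (fun t ht => (hd t (interior_subset ht)).mono interior_subset) fun t ht => ?_
  have := hle t (interior_subset ht)
  have e : ε * (Real.exp (ε * a * t) * (ε * a) * V t + Real.exp (ε * a * t) * V' t) =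
      Real.exp (ε * a * t) * (ε ^ 2 * a * V t + ε * V' t) := by ring
  rw [e]
  exact mul_nonpos_of_nonneg_of_nonpos (Real.exp_nonneg _) (by linarith)

/-- A function which decreases wherever it attains the level `K` stays below that level. -/
theorem le_of_deriv_neg_at_level {V : ℝ → ℝ} {t₀ K : ℝ} (h0 : V t₀ ≤ K)
    (h : ∀ t ≥ t₀, ∃ V', HasDerivWithinAt V V' (Ici t₀) t ∧ (V t = K → V' < 0)) :
    ∀ t ≥ t₀, V t ≤ K := by
  choose! V' hV' hneg using h
  intro T hT
  refine image_le_of_deriv_right_lt_deriv_boundary' (f := V) (f' := V') (a := t₀) (b := T)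
    (B := fun _ => K) (B' := fun _ => 0) ?_ ?_ h0 continuousOn_const
    (fun t _ => hasDerivWithinAt_const _ _ _) (fun t ht => hneg t ht.1) ⟨hT, le_rfl⟩
  · exact fun t ht => (hV' t ht.1).continuousWithinAt.mono fun s hs => hs.1
  · exact fun t ht => (hV' t ht.1).mono fun s hs => ht.1.trans hs

end Lyapunov

/-! ### Global solutions of bounded Lipschitz equations. -/

section GlobalExistence

variable {E : Type*} [NormedAddCommGroup E] [NormedSpace ℝ E] [CompleteSpace E]

/-- Global existence for a bounded vector field which is Lipschitz in space and continuous in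
time. -/
theorem exists_global_solution {G : ℝ → E → E} {K L : NNReal} (hK : ∀ t, LipschitzWith K (G t))
    (hc : ∀ x, Continuous fun t => G t x) (hL : ∀ t x, ‖G t x‖ ≤ L) (t₀ : ℝ) (x₀ : E) :
    ∃ α : ℝ → E, α t₀ = x₀ ∧ ∀ t, HasDerivAt α (G t (α t)) t := by
  have hloc : ∀ n : ℕ, ∃ α : ℝ → E, α t₀ = x₀ ∧
      ∀ t ∈ Ioo (t₀ - n) (t₀ + n), HasDerivAt α (G t (α t)) t := by
    intro n
    have hn : (0 : ℝ) ≤ n := Nat.cast_nonneg n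
    have hmem : t₀ ∈ Icc (t₀ - n) (t₀ + n) := ⟨by linarith, by linarith⟩
    -- A field bounded by `L` moves a point by at most `L * n` in time `n`, so Picard–Lindelöf
    -- applies on intervals of any length.
    have hPL : IsPicardLindelof G (⟨t₀, hmem⟩ : Icc (t₀ - (n : ℝ)) (t₀ + n)) x₀ (L * n) 0 L K :=
      { lipschitzOnWith := fun t _ => (hK t).lipschitzOnWith
        continuousOn := fun x _ => (hc x).continuousOn
        norm_le := fun t _ x _ => hL t x
        mul_max_le := by simp }
    obtain ⟨α, h0, hα⟩ := hPL.exists_eq_forall_mem_Icc_hasDerivWithinAt₀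
    exact ⟨α, h0, fun t ht => (hα t (Ioo_subset_Icc_self ht)).hasDerivAt
      (Icc_mem_nhds ht.1 ht.2)⟩
  choose α h0 hα using hloc
  have hagree : ∀ m n : ℕ, m ≤ n → ∀ t ∈ Ioo (t₀ - m) (t₀ + m), α m t = α n t := by
    intro m n hmn t ht
    have hmn' : (m : ℝ) ≤ n := by exact_mod_cast hmn
    have hm : (0 : ℝ) < m := by have := ht.1.trans ht.2; linarith
    refine ODE_solution_unique_of_mem_Ioo (v := G) (s := fun _ => univ) (K := K) (t₀ := t₀)
      (a := t₀ - m) (b := t₀ + m)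
      (fun t _ => (hK t).lipschitzOnWith) ⟨by linarith, by linarith⟩
      (fun t ht => ⟨hα m t ht, mem_univ _⟩) (fun t ht => ⟨hα n t ⟨?_, ?_⟩, mem_univ _⟩)
      ((h0 m).trans (h0 n).symm) ht
    · linarith [ht.1]
    · linarith [ht.2]
  -- The `+ 1` puts `t` in the open interval even when `|t - t₀|` is an integer.
  set N : ℝ → ℕ := fun t => ⌈|t - t₀|⌉₊ + 1 with hN
  have hmemN : ∀ t, t ∈ Ioo (t₀ - N t) (t₀ + N t) := by
    intro t
    have h1 : |t - t₀| < N t := by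
      have := Nat.le_ceil |t - t₀|
      rw [hN]; push_cast; linarith
    have := abs_lt.1 h1
    exact ⟨by linarith, by linarith⟩
  have hmin : ∀ (n : ℕ) t, t ∈ Ioo (t₀ - n) (t₀ + n) → α (N t) t = α n t := by
    intro n t ht
    rcases le_total (N t) n with h | h
    · exact hagree _ _ h t (hmemN t)
    · exact (hagree _ _ h t ht).symm
  refine ⟨fun t => α (N t) t, h0 _, fun t => ?_⟩
  refine (hα (N t) t (hmemN t)).congr_of_eventuallyEq ?_
  filter_upwards [Ioo_mem_nhds (hmemN t).1 (hmemN t).2] with s hs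
  exact hmin _ s hs

end GlobalExistence

/-! ### The truncated equation. -/

section Truncation

/-- The nearest point projection of the real line onto `[c - R, c + R]`. -/
def clampBall (c R x : ℝ) : ℝ := max (c - R) (min (c + R) x)

theorem clampBall_of_abs_le {c R x : ℝ} (h : |x - c| ≤ R) : clampBall c R x = x := by
  have := abs_le.1 h
  rw [clampBall, min_eq_right (by linarith), max_eq_right (by linarith)]

theorem abs_clampBall_sub_le {c R : ℝ} (hR : 0 ≤ R) (x : ℝ) : |clampBall c R x - c| ≤ R := by
  rw [abs_le, clampBall]
  constructor
  · linarith [le_max_left (c - R) (min (c + R) x)]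
  · have : max (c - R) (min (c + R) x) ≤ c + R := max_le (by linarith) (min_le_left _ _)
    linarith

theorem abs_clampBall_sub_clampBall_le (c R x y : ℝ) :
    |clampBall c R x - clampBall c R y| ≤ |x - y| := by
  unfold clampBall
  refine (abs_max_sub_max_le_max _ _ _ _).trans ?_
  rw [sub_self, abs_zero]
  refine max_le (abs_nonneg _) ((abs_min_sub_min_le_max _ _ _ _).trans ?_)
  rw [sub_self, abs_zero]
  exact max_le (abs_nonneg _) le_rfl

/-- Global solutions of the equation with truncated velocity and truncated restoring force. -/
theorem exists_truncated_solution {g : ℝ → ℝ} {c₀ R a : ℝ} (hs : SlopesNear g c₀ R a) (hR : 0 ≤ R)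
    (ha : 0 ≤ a) {F : ℝ → ℝ} (hF : Continuous F) {B : ℝ} (hB : ∀ t, |F t| ≤ B) {ε M : ℝ}
    (hε : 0 < ε) (hM : 0 ≤ M) (t₀ x₁ v₁ : ℝ) :
    ∃ x v : ℝ → ℝ, x t₀ = x₁ ∧ v t₀ = v₁ ∧ ∀ t, HasDerivAt x (clampBall 0 M (v t)) t ∧
      HasDerivAt v (-(clampBall 0 M (v t)) / ε - g (clampBall c₀ R (x t)) + F t) t := by
  -- Clamping both coordinates makes the field bounded and globally Lipschitz, although `g` is
  -- controlled only near `c₀`.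
  set G : ℝ → ℝ × ℝ → ℝ × ℝ := fun t p =>
    (clampBall 0 M p.2, -(clampBall 0 M p.2) / ε - g (clampBall c₀ R p.1) + F t) with hG
  have hB0 : 0 ≤ B := (abs_nonneg _).trans (hB 0)
  have hM' : ∀ z, |clampBall 0 M z| ≤ M := fun z => by
    simpa using abs_clampBall_sub_le (c := 0) hM z
  have hlip : ∀ t, LipschitzWith (Real.toNNReal (1 + 1 / ε + 2 * a)) (G t) := by
    intro t
    refine LipschitzWith.of_dist_le_mul fun p q => ?_
    rw [Real.coe_toNNReal _ (by positivity)]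
    have h1 : |p.1 - q.1| ≤ dist p q := le_max_left _ _
    have h2 : |p.2 - q.2| ≤ dist p q := le_max_right _ _
    have h3 := (abs_clampBall_sub_clampBall_le 0 M p.2 q.2).trans h2
    have h4 := (abs_clampBall_sub_clampBall_le c₀ R p.1 q.1).trans h1
    have h5 := (hs.abs_sub_le ha (abs_clampBall_sub_le (c := c₀) hR p.1)
      (abs_clampBall_sub_le hR q.1)).trans (mul_le_mul_of_nonneg_left h4 (by positivity))
    have hd : 0 ≤ dist p q := dist_nonneg
    have hdε : 0 ≤ 1 / ε * dist p q := by positivity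
    have hda : 0 ≤ 2 * a * dist p q := by positivity
    rw [Prod.dist_eq]
    refine max_le ?_ ?_
    · rw [Real.dist_eq]
      change |clampBall 0 M p.2 - clampBall 0 M q.2| ≤ _
      linarith
    · rw [Real.dist_eq]
      have e : (G t p).2 - (G t q).2 = -(1 / ε * (clampBall 0 M p.2 - clampBall 0 M q.2)) -
          (g (clampBall c₀ R p.1) - g (clampBall c₀ R q.1)) := by
        simp only [hG]; ring
      rw [e]
      refine (abs_sub _ _).trans ?_
      rw [abs_neg, abs_mul, abs_of_pos (by positivity : 0 < 1 / ε)]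
      have := mul_le_mul_of_nonneg_left h3 (by positivity : 0 ≤ 1 / ε)
      linarith
  have hcont : ∀ p, Continuous fun t => G t p := fun p => by
    simp only [hG]
    fun_prop
  have hgc : ∀ z, |g (clampBall c₀ R z)| ≤ |g c₀| + 2 * a * R := by
    intro z
    have h1 := abs_clampBall_sub_le (c := c₀) hR z
    have h2 := hs.abs_sub_le ha h1 (y := c₀) (by simpa using hR)
    have h3 := mul_le_mul_of_nonneg_left h1 (by positivity : 0 ≤ 2 * a)
    have h4 := abs_sub_abs_le_abs_sub (g (clampBall c₀ R z)) (g c₀)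
    linarith
  have hbound : ∀ t p, ‖G t p‖ ≤ (Real.toNNReal (M + 1 / ε * M + (|g c₀| + 2 * a * R) + B) : ℝ) := by
    intro t p
    have hεM : 0 ≤ 1 / ε * M := by positivity
    have hg0 : 0 ≤ |g c₀| + 2 * a * R := by positivity
    rw [Real.coe_toNNReal _ (by positivity), Prod.norm_def]
    refine max_le ?_ ?_
    · have := hM' p.2
      rw [Real.norm_eq_abs]
      change |clampBall 0 M p.2| ≤ _
      linarith
    · have e : (G t p).2 = -(1 / ε * clampBall 0 M p.2) - g (clampBall c₀ R p.1) + F t := by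
        simp only [hG]; ring
      rw [Real.norm_eq_abs, e]
      have h1 := abs_add_le (-(1 / ε * clampBall 0 M p.2) - g (clampBall c₀ R p.1)) (F t)
      have h2 := abs_sub (-(1 / ε * clampBall 0 M p.2)) (g (clampBall c₀ R p.1))
      rw [abs_neg, abs_mul, abs_of_pos (by positivity : 0 < 1 / ε)] at h2
      have h3 := mul_le_mul_of_nonneg_left (hM' p.2) (by positivity : 0 ≤ 1 / ε)
      linarith [hgc p.1, hB t]
  obtain ⟨γ, h0, hγ⟩ := exists_global_solution hlip hcont hbound t₀ (x₁, v₁)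
  refine ⟨fun t => (γ t).1, fun t => (γ t).2, by simp [h0], by simp [h0], fun t => ⟨?_, ?_⟩⟩
  · exact (ContinuousLinearMap.fst ℝ ℝ ℝ).hasFDerivAt.comp_hasDerivAt t (hγ t)
  · exact (ContinuousLinearMap.snd ℝ ℝ ℝ).hasFDerivAt.comp_hasDerivAt t (hγ t)

end Truncation

theorem TorusPeriodic.exists_bound {d : ℕ} {f : (Fin d → ℝ) → ℝ} (hf : TorusPeriodic f)
    (hc : Continuous f) : ∃ B, ∀ ψ, |f ψ| ≤ B := by
  obtain ⟨B, hB⟩ := isCompact_univ.exists_bound_of_continuousOn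
    (continuous_torusLift hf hc).continuousOn
  refine ⟨B, fun ψ => ?_⟩
  have := hB (fun i => (((2 * Real.pi)⁻¹ • ψ) i : UnitAddCircle)) (mem_univ _)
  rwa [torusLift_coe hf, smul_inv_smul₀ Real.two_pi_pos.ne', Complex.norm_real] at this

/-! ### Stability, attraction and uniqueness. -/

section Stability

variable {d : ℕ} {g : ℝ → ℝ} {f : (Fin d → ℝ) → ℝ} {ω : Fin d → ℝ} {c₀ a ρ ε : ℝ}

/-- Trapping. If `V ≤ 20 ρ²` then `(x - y)² ≤ 40 ρ²`, so `|x - y| ≤ 9 ρ` and `x` is within `10 ρ` of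
`c₀`, where the slopes are controlled. Hence `V` decreases whenever it equals `K`, and no
continuation argument is needed. -/
theorem lyapunov_le_of_isSolutionOn (hs : SlopesNear g c₀ (10 * ρ) a) (hρ : 0 < ρ) (ha : 0 < a)
    (hε0 : 0 < ε) (hεa : 4 * ε ^ 2 * a ≤ 1) {y w : ℝ → ℝ}
    (hy : IsSolutionOn ε g f ω univ y w) (hyρ : ∀ t, |y t - c₀| < ρ) {t₀ K : ℝ}
    {x v : ℝ → ℝ} (hx : IsSolutionOn ε g f ω (Ici t₀) x v) (hK : 0 < K) (hKρ : K ≤ 20 * ρ ^ 2)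
    (h0 : lyapunov ε (x t₀ - y t₀) (v t₀ - w t₀) ≤ K) :
    ∀ t ≥ t₀, lyapunov ε (x t - y t) (v t - w t) ≤ K ∧ |x t - c₀| ≤ 10 * ρ := by
  have hnear : ∀ t, lyapunov ε (x t - y t) (v t - w t) ≤ K → |x t - c₀| ≤ 10 * ρ := by
    intro t ht
    have h1 := sq_le_two_mul_lyapunov ε (x t - y t) (v t - w t)
    have h2 : |x t - y t| ≤ 9 * ρ := abs_le_of_sq_le_sq (by nlinarith) (by positivity)
    have h3 := abs_sub_le (x t) (y t) c₀
    linarith [hyρ t]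
  have hmain := le_of_deriv_neg_at_level (V := fun t => lyapunov ε (x t - y t) (v t - w t)) h0
    (fun t ht => by
      obtain ⟨hx1, α, hα, hxe⟩ := hx t ht
      obtain ⟨hy1, β, hβ, hye⟩ := hy t (mem_univ t)
      refine ⟨_, hasDerivWithinAt_lyapunov hx1 hα (hy1.mono (subset_univ _))
        (hβ.mono (subset_univ _)), fun hVK => ?_⟩
      obtain ⟨b, hb1, hb2, e⟩ := hs _ _ (hnear t hVK.le) ((hyρ t).le.trans (by linarith))
      have h1 := mul_lyapunov_deriv_le (ξ := x t - y t) (η := v t - w t) (q := α - β) hb1 hb2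
        ha.le hεa (by rw [← e]; linarith)
      rw [hVK] at h1
      have h2 : 0 < ε ^ 2 * a * K := by positivity
      exact neg_of_mul_neg_right (h1.trans_lt (by linarith)) hε0.le)
  exact fun t ht => ⟨hmain t ht, hnear t (hmain t ht)⟩

theorem isLyapunovStable_of_slopesNear (hs : SlopesNear g c₀ (10 * ρ) a) (hρ : 0 < ρ) (ha : 0 < a)
    (hε0 : 0 < ε) (hε1 : ε ≤ 1) (hεa : 4 * ε ^ 2 * a ≤ 1) {y : ℝ → ℝ}
    (hy : IsSolutionOn ε g f ω univ y (deriv y)) (hyρ : ∀ t, |y t - c₀| < ρ) :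
    IsLyapunovStable ε g f ω y := by
  intro η hη
  -- The three terms serve the trapping, the position and the velocity; the last carries `ε²`
  -- because `V` controls only `ε` times the velocity.
  set K := min (20 * ρ ^ 2) (min (η ^ 2 / 4) (ε ^ 2 * η ^ 2 / 2)) with hK
  have hK0 : 0 < K := by positivity
  have hK1 : K ≤ η ^ 2 / 4 := (min_le_right _ _).trans (min_le_left _ _)
  have hK2 : K ≤ ε ^ 2 * η ^ 2 / 2 := (min_le_right _ _).trans (min_le_right _ _)
  refine ⟨√(K / 5), by positivity, fun t₀ x v hx h1 h2 t ht => ?_⟩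
  have h0 : lyapunov ε (x t₀ - y t₀) (v t₀ - deriv y t₀) ≤ K := by
    refine (lyapunov_le (by rwa [abs_of_pos hε0]) h1.le h2.le).trans ?_
    rw [Real.sq_sqrt (by positivity)]
    linarith
  have h3 := (lyapunov_le_of_isSolutionOn hs hρ ha hε0 hεa hy hyρ hx hK0 (min_le_left _ _) h0
    t ht).1
  have hη2 : 0 < η ^ 2 := by positivity
  constructor
  · refine abs_lt_of_sq_lt_sq ?_ hη.le
    linarith [sq_le_two_mul_lyapunov ε (x t - y t) (v t - deriv y t)]
  · have h4 := sq_mul_le_lyapunov ε (x t - y t) (v t - deriv y t)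
    have h5 : |ε * (v t - deriv y t)| < ε * η := by
      refine abs_lt_of_sq_lt_sq ?_ (by positivity)
      have : 0 < ε ^ 2 * η ^ 2 := by positivity
      rw [mul_pow ε η]
      linarith
    rw [abs_mul, abs_of_pos hε0] at h5
    exact lt_of_mul_lt_mul_left h5 hε0.le

theorem tendsto_of_isSolutionOn (hs : SlopesNear g c₀ (10 * ρ) a) (hρ : 0 < ρ) (ha : 0 < a)
    (hε0 : 0 < ε) (hεa : 4 * ε ^ 2 * a ≤ 1) {y w : ℝ → ℝ}
    (hy : IsSolutionOn ε g f ω univ y w) (hyρ : ∀ t, |y t - c₀| < ρ) {t₀ : ℝ}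
    {x v : ℝ → ℝ} (hx : IsSolutionOn ε g f ω (Ici t₀) x v)
    (h0 : lyapunov ε (x t₀ - y t₀) (v t₀ - w t₀) ≤ 20 * ρ ^ 2) :
    Tendsto (fun t => x t - y t) atTop (𝓝 0) ∧ Tendsto (fun t => v t - w t) atTop (𝓝 0) := by
  have hnear := lyapunov_le_of_isSolutionOn hs hρ ha hε0 hεa hy hyρ hx (by positivity) le_rfl h0
  have hanti := antitoneOn_mul_exp_mul (ε := ε) (a := a)
    (V := fun t => lyapunov ε (x t - y t) (v t - w t)) (convex_Ici t₀) (fun t ht => by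
      obtain ⟨hx1, α, hα, hxe⟩ := hx t ht
      obtain ⟨hy1, β, hβ, hye⟩ := hy t (mem_univ t)
      exact exists_hasDerivWithinAt_lyapunov_le hs ha.le hεa hx1 hα (hy1.mono (subset_univ _))
        (hβ.mono (subset_univ _)) hxe hye (hnear t ht).2 ((hyρ t).le.trans (by linarith)))
  set V := fun t => lyapunov ε (x t - y t) (v t - w t) with hV
  have hV0 : Tendsto V atTop (𝓝 0) := by
    have hexp : Tendsto (fun t => Real.exp (ε * a * t₀) * V t₀ * Real.exp (-(ε * a * t))) atTop
        (𝓝 0) := by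
      have h1 : Tendsto (fun t : ℝ => ε * a * t) atTop atTop :=
        tendsto_id.const_mul_atTop (by positivity)
      simpa using (Real.tendsto_exp_neg_atTop_nhds_zero.comp h1).const_mul
        (Real.exp (ε * a * t₀) * V t₀)
    refine squeeze_zero' (Eventually.of_forall fun t => lyapunov_nonneg _ _ _) ?_ hexp
    filter_upwards [eventually_ge_atTop t₀] with t ht
    have h1 : ε * (Real.exp (ε * a * t) * V t) ≤ ε * (Real.exp (ε * a * t₀) * V t₀) :=
      hanti self_mem_Ici ht ht
    have h2 := le_of_mul_le_mul_left h1 hε0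
    rw [Real.exp_neg, ← div_eq_mul_inv, le_div_iff₀ (Real.exp_pos _), mul_comm]
    exact h2
  constructor
  · rw [tendsto_zero_iff_abs_tendsto_zero]
    have h1 : Tendsto (fun t => √(2 * V t)) atTop (𝓝 0) := by
      simpa using (hV0.const_mul 2).sqrt
    exact squeeze_zero (fun _ => abs_nonneg _)
      (fun t => Real.abs_le_sqrt (sq_le_two_mul_lyapunov _ _ _)) h1
  · rw [tendsto_zero_iff_abs_tendsto_zero]
    have h1 : Tendsto (fun t => ε⁻¹ * √(V t)) atTop (𝓝 0) := by
      simpa using hV0.sqrt.const_mul ε⁻¹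
    refine squeeze_zero (fun _ => abs_nonneg _) (fun t => ?_) h1
    have h2 := Real.abs_le_sqrt (sq_mul_le_lyapunov ε (x t - y t) (v t - w t))
    rw [abs_mul, abs_of_pos hε0] at h2
    rw [← div_eq_inv_mul, le_div_iff₀ hε0, mul_comm]
    exact h2

/-- The solution is that of a truncated equation. Where `V ≤ 20 ρ²` the clamps are inactive, so at
the level `20 ρ²` the original differential inequality applies and the level is never crossed; the
truncated solution then solves the original equation. -/
theorem exists_isSolutionOn_Ici (hs : SlopesNear g c₀ (10 * ρ) a) (hρ : 0 < ρ) (ha : 0 < a)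
    (hf : TorusPeriodic f) (hfc : Continuous f)
    (hε0 : 0 < ε) (hεa : 4 * ε ^ 2 * a ≤ 1) {y w : ℝ → ℝ}
    (hy : IsSolutionOn ε g f ω univ y w) (hyρ : ∀ t, |y t - c₀| < ρ ∧ |w t| < ρ) {t₀ x₁ v₁ : ℝ}
    (h0 : lyapunov ε (x₁ - y t₀) (v₁ - w t₀) ≤ 20 * ρ ^ 2) :
    ∃ x v : ℝ → ℝ, IsSolutionOn ε g f ω (Ici t₀) x v ∧ x t₀ = x₁ ∧ v t₀ = v₁ := by
  obtain ⟨B, hB⟩ := hf.exists_bound hfc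
  -- From `V ≤ 20 ρ²` one gets `|ε (v - w)| ≤ 5 ρ`, and `|w| < ρ`; this gives the velocity cutoff `ρ
  -- + 5 ρ / ε`.
  obtain ⟨x, v, hx0, hv0, hxv⟩ := exists_truncated_solution (F := fun t => f (t • ω)) (B := B)
    (M := ρ + 5 * ρ / ε) hs (by positivity) ha.le (by fun_prop) (fun t => hB _) hε0 (by positivity)
    t₀ x₁ v₁
  refine ⟨x, v, ?_, hx0, hv0⟩
  have hnear : ∀ t, lyapunov ε (x t - y t) (v t - w t) ≤ 20 * ρ ^ 2 →
      |x t - c₀| ≤ 10 * ρ ∧ |v t - 0| ≤ ρ + 5 * ρ / ε := by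
    intro t ht
    have h1 := sq_le_two_mul_lyapunov ε (x t - y t) (v t - w t)
    have h2 : |x t - y t| ≤ 9 * ρ := abs_le_of_sq_le_sq (by nlinarith) (by positivity)
    have h3 := abs_sub_le (x t) (y t) c₀
    refine ⟨by linarith [(hyρ t).1], ?_⟩
    have h4 := sq_mul_le_lyapunov ε (x t - y t) (v t - w t)
    have h5 : |ε * (v t - w t)| ≤ 5 * ρ := abs_le_of_sq_le_sq (by nlinarith) (by positivity)
    rw [abs_mul, abs_of_pos hε0, mul_comm, ← le_div_iff₀ hε0] at h5
    have h6 := abs_sub_abs_le_abs_sub (v t) (w t)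
    rw [sub_zero]
    linarith [(hyρ t).2]
  have hsol : ∀ t, lyapunov ε (x t - y t) (v t - w t) ≤ 20 * ρ ^ 2 →
      HasDerivAt x (v t) t ∧ HasDerivAt v (-v t / ε - g (x t) + f (t • ω)) t := by
    intro t ht
    obtain ⟨h1, h2⟩ := hnear t ht
    have h3 := hxv t
    rw [clampBall_of_abs_le h1, clampBall_of_abs_le h2] at h3
    exact h3
  have heq : ∀ t, ε * (-v t / ε - g (x t) + f (t • ω)) + v t + ε * g (x t) = ε * f (t • ω) := by
    intro t
    field_simp
    ring
  have hmain := le_of_deriv_neg_at_level (V := fun t => lyapunov ε (x t - y t) (v t - w t))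
    (K := 20 * ρ ^ 2) (t₀ := t₀) (by simpa only [hx0, hv0] using h0)
    (fun t ht => by
      obtain ⟨hy1, β, hβ, hye⟩ := hy t (mem_univ t)
      refine ⟨_, hasDerivWithinAt_lyapunov (hxv t).1.hasDerivWithinAt (hxv t).2.hasDerivWithinAt
        (hy1.mono (subset_univ _)) (hβ.mono (subset_univ _)), fun hVK => ?_⟩
      obtain ⟨h1, h2⟩ := hnear t hVK.le
      rw [clampBall_of_abs_le h1, clampBall_of_abs_le h2]
      obtain ⟨b, hb1, hb2, e⟩ := hs _ _ h1 ((hyρ t).1.le.trans (by linarith))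
      have h3 := mul_lyapunov_deriv_le (ξ := x t - y t) (η := v t - w t)
        (q := -v t / ε - g (x t) + f (t • ω) - β) hb1 hb2
        ha.le hεa (by rw [← e]; linarith [heq t])
      rw [hVK] at h3
      have h4 : 0 < ε ^ 2 * a * (20 * ρ ^ 2) := by positivity
      exact neg_of_mul_neg_right (h3.trans_lt (by linarith)) hε0.le)
  intro t ht
  obtain ⟨h1, h2⟩ := hsol t (hmain t ht)
  exact ⟨h1.hasDerivWithinAt, _, h2.hasDerivWithinAt, heq t⟩

theorem attractsBox_of_slopesNear (hs : SlopesNear g c₀ (10 * ρ) a) (hρ : 0 < ρ) (ha : 0 < a)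
    (hf : TorusPeriodic f) (hfc : Continuous f)
    (hε0 : 0 < ε) (hε1 : ε ≤ 1) (hεa : 4 * ε ^ 2 * a ≤ 1) {y : ℝ → ℝ}
    (hy : IsSolutionOn ε g f ω univ y (deriv y))
    (hyρ : ∀ t, |y t - c₀| < ρ ∧ |deriv y t| < ρ) :
    AttractsBox ε g f ω y c₀ ρ := by
  intro t₀ x₁ v₁ hx₁ hv₁
  -- Two points of the box differ by at most `2 ρ` in each coordinate, and `5 (2 ρ)² = 20 ρ²`.
  have h0 : lyapunov ε (x₁ - y t₀) (v₁ - deriv y t₀) ≤ 20 * ρ ^ 2 := by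
    have h1 : |x₁ - y t₀| ≤ 2 * ρ := by
      have := abs_sub_le x₁ c₀ (y t₀)
      rw [abs_sub_comm c₀] at this
      linarith [(hyρ t₀).1]
    have h2 : |v₁ - deriv y t₀| ≤ 2 * ρ := by
      have := abs_sub v₁ (deriv y t₀)
      linarith [(hyρ t₀).2]
    have := lyapunov_le (by rwa [abs_of_pos hε0]) h1 h2
    linarith
  refine ⟨exists_isSolutionOn_Ici hs hρ ha hf hfc hε0 hεa hy hyρ h0, fun x v hx hx0 hv0 => ?_⟩
  exact tendsto_of_isSolutionOn hs hρ ha hε0 hεa hy (fun t => (hyρ t).1) hx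
    (by rwa [hx0, hv0])

/-- Two solutions in the box have `V ≤ 20 ρ²` at all times. Comparing time `t` with times `s` far in
the past (`ε > 0`) or far in the future (`ε < 0`) bounds `e ^ (ε a t) * V t` by `20 ρ² e ^ (ε a s)`,
which tends to `0`. -/
theorem uniqueInBox_of_slopesNear (hs : SlopesNear g c₀ (10 * ρ) a) (hρ : 0 < ρ) (ha : 0 < a)
    (hε0 : ε ≠ 0) (hε1 : |ε| ≤ 1) (hεa : 4 * ε ^ 2 * a ≤ 1) {y : ℝ → ℝ}
    (hy : IsSolutionOn ε g f ω univ y (deriv y))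
    (hyρ : ∀ t, |y t - c₀| < ρ ∧ |deriv y t| < ρ) :
    UniqueInBox ε g f ω y c₀ ρ := by
  refine ⟨hyρ, fun x v hx hxρ => ?_⟩
  have hanti := antitoneOn_mul_exp_mul (ε := ε) (a := a)
    (V := fun t => lyapunov ε (x t - y t) (v t - deriv y t)) convex_univ (fun t ht => by
      obtain ⟨hx1, α, hα, hxe⟩ := hx t ht
      obtain ⟨hy1, β, hβ, hye⟩ := hy t (mem_univ t)
      exact exists_hasDerivWithinAt_lyapunov_le hs ha.le hεa hx1 hα hy1 hβ hxe hye
        ((hxρ t).1.le.trans (by linarith)) ((hyρ t).1.le.trans (by linarith)))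
  rw [antitoneOn_univ] at hanti
  set V := fun t => lyapunov ε (x t - y t) (v t - deriv y t) with hV
  have hVle : ∀ t, V t ≤ 20 * ρ ^ 2 := by
    intro t
    have h1 : |x t - y t| ≤ 2 * ρ := by
      have := abs_sub_le (x t) c₀ (y t)
      rw [abs_sub_comm c₀] at this
      linarith [(hyρ t).1, (hxρ t).1]
    have h2 : |v t - deriv y t| ≤ 2 * ρ := by
      have := abs_sub (v t) (deriv y t)
      linarith [(hyρ t).2, (hxρ t).2]
    have := lyapunov_le hε1 h1 h2
    linarith
  have hle : ∀ t s : ℝ, 0 ≤ ε * (t - s) →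
      Real.exp (ε * a * t) * V t ≤ 20 * ρ ^ 2 * Real.exp (ε * a * s) := by
    intro t s hst
    have h1 : Real.exp (ε * a * t) * V t ≤ Real.exp (ε * a * s) * V s := by
      rcases lt_or_gt_of_ne hε0 with h | h
      · have hts : t ≤ s := by
          by_contra hc
          have := mul_neg_of_neg_of_pos h (sub_pos.2 (not_le.1 hc))
          linarith
        exact (mul_le_mul_left_of_neg h).1 (hanti hts)
      · have hts : s ≤ t := by
          by_contra hc
          have := mul_neg_of_pos_of_neg h (sub_neg.2 (not_le.1 hc))
          linarith
        exact le_of_mul_le_mul_left (hanti hts) h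
    refine h1.trans ?_
    rw [mul_comm]
    exact mul_le_mul_of_nonneg_right (hVle s) (Real.exp_nonneg _)
  funext t
  -- The choice `s = t - τ / ε` treats both signs at once: the exponent is `ε a t - a τ`.
  have hlim : Tendsto (fun τ : ℝ => 20 * ρ ^ 2 * Real.exp (ε * a * (t - τ / ε))) atTop (𝓝 0) := by
    have h1 : Tendsto (fun τ : ℝ => a * τ - ε * a * t) atTop atTop :=
      tendsto_atTop_add_const_right _ _ (tendsto_id.const_mul_atTop ha)
    have h2 := (Real.tendsto_exp_neg_atTop_nhds_zero.comp h1).const_mul (20 * ρ ^ 2)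
    rw [mul_zero] at h2
    refine h2.congr fun τ => ?_
    rw [Function.comp_apply]
    congr 2
    field_simp
    ring
  have h1 : Real.exp (ε * a * t) * V t ≤ 0 := by
    refine ge_of_tendsto hlim ?_
    filter_upwards [eventually_ge_atTop (0 : ℝ)] with τ hτ
    refine hle t _ ?_
    rw [sub_sub_cancel, mul_div_cancel₀ _ hε0]
    exact hτ
  have h2 : V t ≤ 0 := by
    by_contra hc
    have := mul_pos (Real.exp_pos (ε * a * t)) (not_le.1 hc)
    linarith
  have h3 := sq_le_two_mul_lyapunov ε (x t - y t) (v t - deriv y t)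
  have h4 : (x t - y t) ^ 2 = 0 := le_antisymm (h3.trans (by linarith)) (sq_nonneg _)
  exact sub_eq_zero.1 (pow_eq_zero_iff two_ne_zero |>.1 h4)

end Stability

end

/-! ### The main theorem. -/

theorem theorem1 (d : ℕ) (g : ℝ → ℝ) (f : (Fin d → ℝ) → ℝ)
    (hg : AnalyticOnNhd ℝ g Set.univ) (hf : TorusAnalytic f)
    (ω : Fin d → ℝ) (c₀ : ℝ) (hc₀ : IsSimpleZero (fun x => g x - meanValue f ω) c₀) :
    ∃ ε₀ > 0, ∃ X : ℝ → (Fin d → ℝ) → ℝ,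
      (∀ ε : ℝ, |ε| < ε₀ →
        TorusAnalytic (X ε) ∧
        IsSolutionOn ε g f ω Set.univ
          (responseMotion c₀ (X ε) ω) (deriv (responseMotion c₀ (X ε) ω))) ∧
      TendstoUniformly X (fun _ => 0) (𝓝 0) ∧
      (0 < deriv g c₀ →
        ∃ ρ > 0,
          (∀ ε : ℝ, 0 < ε → ε < ε₀ →
            IsLyapunovStable ε g f ω (responseMotion c₀ (X ε) ω) ∧
            AttractsBox ε g f ω (responseMotion c₀ (X ε) ω) c₀ ρ) ∧
          (∀ ε : ℝ, ε ≠ 0 → |ε| < ε₀ →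
            UniqueInBox ε g f ω (responseMotion c₀ (X ε) ω) c₀ ρ)) := by
  have hgc := hg c₀ (Set.mem_univ c₀)
  have h0 : g c₀ = meanValue f ω := sub_eq_zero.1 hc₀.1
  have h1 : deriv g c₀ ≠ 0 := by
    have := hc₀.2
    rwa [deriv_sub_const] at this
  obtain ⟨ρ, hρ, hslopes⟩ : ∃ ρ > 0, 0 < deriv g c₀ → SlopesNear g c₀ (10 * ρ) (deriv g c₀) := by
    by_cases ha : 0 < deriv g c₀
    · obtain ⟨R, hR, h⟩ := exists_slopesNear hgc ha
      refine ⟨R / 10, by positivity, fun _ => ?_⟩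
      rwa [mul_div_cancel₀ R (by norm_num : (10 : ℝ) ≠ 0)]
    · exact ⟨1, one_pos, fun h => absurd h ha⟩
  obtain ⟨ε₁, hε₁, hε₁1, X, hX, hunif⟩ := exists_responseMotion hgc hf ω h0 h1 hρ
  -- Together with `|ε| ≤ 1`, the second bound gives `4 ε² g'(c₀) ≤ 1`, the smallness used by the
  -- Lyapunov estimates.
  refine ⟨min ε₁ (1 / (4 * |deriv g c₀|)), by positivity, X, fun ε hε => ?_, hunif, fun ha => ?_⟩
  · obtain ⟨h2, h3, -⟩ := hX ε (hε.trans_le (min_le_left _ _))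
    exact ⟨h2, h3⟩
  · have hs := hslopes ha
    have hsmall : ∀ ε : ℝ, |ε| < min ε₁ (1 / (4 * |deriv g c₀|)) →
        |ε| ≤ 1 ∧ 4 * ε ^ 2 * deriv g c₀ ≤ 1 := by
      intro ε hε
      have h2 : |ε| ≤ 1 := (hε.le.trans (min_le_left _ _)).trans hε₁1
      have h3 := hε.le.trans (min_le_right _ _)
      rw [le_div_iff₀ (by positivity), abs_of_pos ha] at h3
      refine ⟨h2, ?_⟩
      calc 4 * ε ^ 2 * deriv g c₀ = |ε| * (|ε| * (4 * deriv g c₀)) := by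
            rw [← sq_abs]; ring
        _ ≤ 1 * 1 := by gcongr
        _ = 1 := one_mul 1
    refine ⟨ρ, hρ, fun ε hε0 hε => ?_, fun ε hε0 hε => ?_⟩
    · have hε' : |ε| < min ε₁ (1 / (4 * |deriv g c₀|)) := by rwa [abs_of_pos hε0]
      obtain ⟨-, hsol, hbox⟩ := hX ε (hε'.trans_le (min_le_left _ _))
      obtain ⟨h2, h3⟩ := hsmall ε hε'
      rw [abs_of_pos hε0] at h2
      exact ⟨isLyapunovStable_of_slopesNear hs hρ ha hε0 h2 h3 hsol fun t => (hbox t).1,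
        attractsBox_of_slopesNear hs hρ ha hf.2 hf.1.continuous hε0 h2 h3 hsol hbox⟩
    · obtain ⟨-, hsol, hbox⟩ := hX ε (hε.trans_le (min_le_left _ _))
      obtain ⟨h2, h3⟩ := hsmall ε hε
      exact uniqueInBox_of_slopesNear hs hρ ha hε0 h2 h3 hsol hbox
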